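/- Let $c\in\mathbb R$ with $|c|>1$. Functions on $\mathbb R$ are complex-valued unless said otherwise. For real $r\ge 0$ and $q>0$ let $H^r_q=\{f\in H^r(\mathbb R):\cosh^q(\cdot)f\in H^r(\mathbb R)\}$ with norm $\|f\|_{r,q}=\|\cosh^q(\cdot)f\|_{H^r}$, let $E^r_q$ be the subspace of even functions in $H^r_q$, and let $E^r_{q,0}=\{f\in E^r_q:\hat f(0)=0\}$, i.e. $\int_{\mathbb R}f=0$. Let $(Af)(x)=f(x+1)+f(x-1)$. An operator is called invertible from $X$ to $Y$ if it is a bounded linear bijection from $X$ onto $Y$ with bounded inverse. Assume the following. 1. There are $q_\varsigma>0$ and a real-valued $\varsigma\in E^2_{q_\varsigma}$ such that $c^2\varsigma''+(2-A)(\varsigma+\varsigma^2)=0$. 2. There is $q_{\mathcal H}\in(0,\min\{1,q_\varsigma\})$ such that the operator $\mathcal H_cf:=c^2f''+(2-A)\big((1+2\varsigma)f\big)$ is invertible from $E^2_{q_{\mathcal H}}$ to $E^0_{q_{\mathcal H},0}$. Then there exist $q^\star_{\mathcal H},q^{\star\star}_{\mathcal H}$ with $q_{\mathcal H}\le q^\star_{\mathcal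 H}<q^{\star\star}_{\mathcal H}<\min\{1,q_\varsigma\}$ such that for every $q\in[q^\star_{\mathcal H},q^{\star\star}_{\mathcal H}]$ and every real $r\ge 0$, the operator $\mathcal H_c$ is invertible from $E^{r+2}_q$ to $E^r_{q,0}$. -/

import Mathlib

open MeasureTheory Filter
open scoped ENNReal NNReal SchwartzMap LineDeriv FourierTransform

noncomputable section

namespace MonatomicFPUT

/-- Complex-valued square integrable functions on the line, modulo a.e. equality. -/
abbrev L2 : Type := Lp ℂ 2 (volume : Measure ℝ)

/-- The Sobolev space `H^r(ℝ)` of complex-valued functions, as a subspace of `L²` (`r ≥ 0`). -/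
def sobolev (r : ℝ) : Submodule ℂ L2 where
  carrier := {f | TemperedDistribution.MemSobolev r 2 (f : 𝓢'(ℝ, ℂ))}
  zero_mem' := by
    have h := TemperedDistribution.memSobolev_fun_zero ℝ ℂ r 2
    rw [← map_zero (Lp.toTemperedDistributionCLM ℂ (volume : Measure ℝ) 2)] at h
    exact h
  add_mem' := by
    intro f g hf hg
    have h := TemperedDistribution.MemSobolev.add hf hg
    rw [← Lp.toTemperedDistributionCLM_apply, ← Lp.toTemperedDistributionCLM_apply,
      ← map_add] at h
    exact h
  smul_mem' := by
    intro a f hf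
    have h := TemperedDistribution.MemSobolev.smul a hf
    rw [← Lp.toTemperedDistributionCLM_apply, ← map_smul] at h
    exact h

/-- The `H^r(ℝ)` norm `‖(1 + k²)^{r/2} f̂(k)‖_{L²}`. Mathlib's Fourier variable `ξ` is related to
the angular frequency by `k = 2πξ`, and `𝓕` is unitary on `L²`. -/
def sobolevENorm (r : ℝ) (f : L2) : ℝ≥0∞ :=
  eLpNorm (fun ξ : ℝ => (((1 + (2 * Real.pi * ξ) ^ 2) ^ (r / 2) : ℝ) : ℂ) * (𝓕 f : L2) ξ) 2 volume

/-- The pointwise product `cosh(x)^q f(x)`. -/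
def coshMul (q : ℝ) (f : ℝ → ℂ) (x : ℝ) : ℂ := ((Real.cosh x ^ q : ℝ) : ℂ) * f x

/-- `H_q^r = {f ∈ H^r : cosh^q f ∈ H^r}`. -/
def weightedSobolev (r q : ℝ) : Submodule ℂ L2 where
  carrier := {f | f ∈ sobolev r ∧ ∃ g ∈ sobolev r, g =ᵐ[volume] coshMul q f}
  zero_mem' := by
    refine ⟨zero_mem _, 0, zero_mem _, ?_⟩
    filter_upwards [Lp.coeFn_zero ℂ 2 (volume : Measure ℝ)] with x hx
    simp only [coshMul]
    rw [hx]
    simp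
  add_mem' := by
    rintro f₁ f₂ ⟨h₁, g₁, hg₁, e₁⟩ ⟨h₂, g₂, hg₂, e₂⟩
    refine ⟨add_mem h₁ h₂, g₁ + g₂, add_mem hg₁ hg₂, ?_⟩
    filter_upwards [e₁, e₂, Lp.coeFn_add f₁ f₂, Lp.coeFn_add g₁ g₂] with x a b c d
    simp only [coshMul, Pi.add_apply] at *
    rw [d, a, b, c, mul_add]
  smul_mem' := by
    rintro a f ⟨h, g, hg, e⟩
    refine ⟨Submodule.smul_mem _ a h, a • g, Submodule.smul_mem _ a hg, ?_⟩
    filter_upwards [e, Lp.coeFn_smul a f, Lp.coeFn_smul a g] with x b c d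
    simp only [coshMul, Pi.smul_apply, smul_eq_mul] at *
    rw [d, b, c]
    ring

/-- The norm `‖f‖_{r,q} = ‖cosh^q f‖_{H^r}`. At most one `g` in `L²` satisfies the condition, so
the infimum is its `H^r` norm (and `∞` if there is none). -/
def weightedENorm (r q : ℝ) (f : L2) : ℝ≥0∞ :=
  ⨅ (g : L2) (_ : g =ᵐ[volume] coshMul q f), sobolevENorm r g

/-- Even functions in `L²`. -/
def evenL2 : Submodule ℂ L2 where
  carrier := {f | ∀ᵐ x : ℝ, f (-x) = f x}
  zero_mem' := by
    have h := Lp.coeFn_zero ℂ 2 (volume : Measure ℝ)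
    filter_upwards [h, (Measure.measurePreserving_neg (volume : Measure ℝ)).quasiMeasurePreserving.ae h]
      with x a b
    rw [a, b]
    rfl
  add_mem' := by
    intro f g hf hg
    have h := Lp.coeFn_add f g
    filter_upwards [hf, hg, h,
      (Measure.measurePreserving_neg (volume : Measure ℝ)).quasiMeasurePreserving.ae h]
      with x a b c d
    rw [c, d, Pi.add_apply, Pi.add_apply, a, b]
  smul_mem' := by
    intro s f hf
    have h := Lp.coeFn_smul s f
    filter_upwards [hf, h,
      (Measure.measurePreserving_neg (volume : Measure ℝ)).quasiMeasurePreserving.ae h]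
      with x a c d
    rw [c, d, Pi.smul_apply, Pi.smul_apply, a]

/-- Mean-zero functions, that is, `f̂(0) = (2π)^{-1/2} ∫ f = 0`. -/
def meanZeroL2 : Submodule ℂ L2 where
  carrier := {f | Integrable f (volume : Measure ℝ) ∧ ∫ x : ℝ, f x = 0}
  zero_mem' := by
    have h := Lp.coeFn_zero ℂ 2 (volume : Measure ℝ)
    refine ⟨(integrable_congr h).2 (integrable_zero _ _ _), ?_⟩
    rw [integral_congr_ae h]
    simp
  add_mem' := by
    rintro f g ⟨hf, hf0⟩ ⟨hg, hg0⟩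
    have h := Lp.coeFn_add f g
    refine ⟨(integrable_congr h).2 (hf.add hg), ?_⟩
    rw [integral_congr_ae h, integral_add' hf hg, hf0, hg0, add_zero]
  smul_mem' := by
    rintro s f ⟨hf, hf0⟩
    have h := Lp.coeFn_smul s f
    refine ⟨(integrable_congr h).2 (hf.smul s), ?_⟩
    rw [integral_congr_ae h]
    simp only [Pi.smul_apply]
    rw [integral_smul, hf0, smul_zero]

/-- `E_q^r = H_q^r ∩ {even functions}`. -/
def E (r q : ℝ) : Submodule ℂ L2 := weightedSobolev r q ⊓ evenL2

/-- `E_{q,0}^r = {f ∈ E_q^r : f̂(0) = 0}`. For `q > 0` every element of `E_q^r` is integrable. -/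
def E₀ (r q : ℝ) : Submodule ℂ L2 := E r q ⊓ meanZeroL2

open Classical in
/-- The second (distributional) derivative of `f`, when it lies in `L²`, as it does for
`f ∈ H²`; the value `0` otherwise is never used. -/
def secondDeriv (f : L2) : L2 :=
  if h : ∃ g : L2, (g : 𝓢'(ℝ, ℂ)) = ∂_{(1 : ℝ)} (∂_{(1 : ℝ)} (f : 𝓢'(ℝ, ℂ))) then h.choose else 0

theorem secondDeriv_spec {r : ℝ} (hr : 2 ≤ r) {f : L2} (hf : f ∈ sobolev r) :
    (secondDeriv f : 𝓢'(ℝ, ℂ)) = ∂_{(1 : ℝ)} (∂_{(1 : ℝ)} (f : 𝓢'(ℝ, ℂ))) := by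
  have h : ∃ g : L2, (g : 𝓢'(ℝ, ℂ)) = ∂_{(1 : ℝ)} (∂_{(1 : ℝ)} (f : 𝓢'(ℝ, ℂ))) := by
    have h₁ : TemperedDistribution.MemSobolev r 2 (f : 𝓢'(ℝ, ℂ)) := hf
    have h₂ := (h₁.lineDerivOp (m := (1 : ℝ))).lineDerivOp (m := (1 : ℝ))
    obtain ⟨g, hg⟩ := TemperedDistribution.memSobolev_zero_iff.1
      (h₂.mono (s' := 0) (by linarith))
    exact ⟨g, hg.symm⟩
  rw [secondDeriv, dif_pos h]
  exact h.choose_spec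

/-- `(2 - A) g = 2 g - S^1 g - S^{-1} g`, where `(S^d g)(x) = g (x + d)`. -/
def twoSubA (g : ℝ → ℂ) (x : ℝ) : ℂ := 2 * g x - (g (x + 1) + g (x - 1))

/-- `ς` solves the monatomic travelling wave equation `c² ς'' + (2 - A)(ς + ς²) = 0`. -/
def IsTravelingWave (c : ℝ) (ς : L2) : Prop :=
  ∀ᵐ x : ℝ, (c : ℂ) ^ 2 * secondDeriv ς x + twoSubA (fun y => ς y + ς y ^ 2) x = 0

/-- The linearization `H_c f = c² f'' + (2 - A)((1 + 2 ς) f)`. -/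
def linearization (c : ℝ) (ς f : L2) (x : ℝ) : ℂ :=
  (c : ℂ) ^ 2 * secondDeriv f x + twoSubA (fun y => (1 + 2 * ς y) * f y) x

/-- `H_c` is invertible from `E_q^s` to `E_{q,0}^r`: it is a linear bijection between these spaces,
and both it and its inverse are bounded. -/
def IsInvertible (c : ℝ) (ς : L2) (s r q : ℝ) : Prop :=
  ∃ T : E s q ≃ₗ[ℂ] E₀ r q,
    (∀ f : E s q, (T f : L2) =ᵐ[volume] linearization c ς f) ∧
    (∃ C : ℝ≥0, ∀ f : E s q, weightedENorm r q (T f) ≤ C * weightedENorm s q f) ∧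
    (∃ C : ℝ≥0, ∀ g : E₀ r q, weightedENorm s q (T.symm g) ≤ C * weightedENorm r q g)

end MonatomicFPUT

end

noncomputable section

namespace MonatomicFPUT

/-! ### Weak derivatives and the Sobolev scale on the Fourier side -/

/-! The weight is removed by conjugation. Writing `f = cosh^{-q} U` identifies the weighted norm of
`f` with the `H^r` norm of `U`, and turns `H_c` into `conjOp c σ q`, with `σ = 1 + 2ς`: the operator
`c² ∂²` plus terms of order at most one, whose coefficients are smooth with bounded derivatives and
depend on `q`. The mean-zero condition becomes orthogonality of the right-hand side to `cosh^{-q}`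
in `L²`. All weights are thus compared on one fixed pair of spaces, the even functions in `H²` and
in `L²`.

Take `p = qH` as base weight. Injectivity at a weight `q ≥ p` is inherited: multiplication by
`cosh^{-(q-p)}` intertwines the operators at `q` and `p`, so it carries the kernel at `q` into the
trivial kernel at `p` (`mulL_coshNeg_conjOp`, `EvenInjective.mono`). Surjectivity is a perturbation
argument. The conjugated operators are norm continuous in `q` from `H²` to `L²`
(`exists_conjOp_sub_le`), but their ranges lie in different hyperplanes `(cosh^{-q})^⊥`. The
equation at `q` is therefore projected onto the even part of `(cosh^{-p})^⊥` and solved there by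
contraction. The remaining error is a multiple of `cosh^{-p}` that is orthogonal to `cosh^{-q}`, and
so vanishes because `∫ cosh^{-(p+q)} > 0` (`Solvable.exists_nhds`).

This fixes an interval of weights at the level `H² → L²`. Every other order `r` follows on the same
interval by elliptic regularity: `c ≠ 0` allows `U''` to be expressed through the data and
lower-order terms (`conjOp_regularity`). The coefficients are smooth because the travelling wave
equation bootstraps `ς` to a function with bounded derivatives of every order
(`exists_bddSmooth_rep`). -/

theorem L2.locallyIntegrable (u : L2) : LocallyIntegrable u (volume : Measure ℝ) :=
  (Lp.memLp u).locallyIntegrable (by norm_num)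

theorem locallyIntegrable_continuous_mul {h u : ℝ → ℂ} (hh : Continuous h)
    (hu : LocallyIntegrable u (volume : Measure ℝ)) : LocallyIntegrable (fun x => h x * u x) := by
  rw [← locallyIntegrableOn_univ] at hu ⊢
  exact hu.continuousOn_mul hh.continuousOn isOpen_univ.isLocallyClosed

/-- This passes between identities of tempered distributions and identities almost everywhere. Real
compactly supported test functions, viewed as Schwartz functions, already separate locally
integrable functions. -/
theorem coe_eq_smulLeftCLM_iff {h : ℝ → ℂ} (hh : h.HasTemperateGrowth) (u v : L2) :
    (v : 𝓢'(ℝ, ℂ)) = TemperedDistribution.smulLeftCLM ℂ h (u : 𝓢'(ℝ, ℂ)) ↔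
      v =ᵐ[volume] fun x => h x * u x := by
  constructor
  · intro H
    refine ae_eq_of_integral_contDiff_smul_eq (L2.locallyIntegrable v)
      (locallyIntegrable_continuous_mul hh.1.continuous (L2.locallyIntegrable u)) ?_
    intro g g_smooth g_cpt
    have hg₁ : HasCompactSupport (Complex.ofRealCLM ∘ g) := g_cpt.comp_left rfl
    have hg₂ : ContDiff ℝ ((⊤ : ℕ∞) : WithTop ℕ∞) (Complex.ofRealCLM ∘ g) := by fun_prop
    have := DFunLike.congr_fun H (hg₁.toSchwartzMap hg₂)
    simp only [Lp.toTemperedDistribution_apply, TemperedDistribution.smulLeftCLM_apply_apply] at this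
    have e1 : ∀ x, (hg₁.toSchwartzMap hg₂) x = (g x : ℂ) := fun x => rfl
    simp only [SchwartzMap.smulLeftCLM_apply_apply hh, e1] at this
    simp only [Complex.real_smul]
    simp only [smul_eq_mul] at this
    rw [this]
    refine integral_congr_ae (Eventually.of_forall fun x => ?_)
    simp only
    ring
  · intro H
    ext φ
    simp only [Lp.toTemperedDistribution_apply, TemperedDistribution.smulLeftCLM_apply_apply]
    refine integral_congr_ae ?_
    filter_upwards [H] with x hx
    rw [hx, SchwartzMap.smulLeftCLM_apply_apply hh]
    simp only [smul_eq_mul]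
    ring

/-- `g` is the distributional derivative of `f`. -/
def WeakDeriv (f g : L2) : Prop := (g : 𝓢'(ℝ, ℂ)) = ∂_{(1 : ℝ)} (f : 𝓢'(ℝ, ℂ))

theorem toTemperedDistribution_injective {f g : L2} (h : (f : 𝓢'(ℝ, ℂ)) = (g : 𝓢'(ℝ, ℂ))) :
    f = g := by
  have := Lp.ker_toTemperedDistributionCLM_eq_bot (F := ℂ) (μ := (volume : Measure ℝ)) (p := 2)
  rw [LinearMap.ker_eq_bot] at this
  exact this h

theorem WeakDeriv.unique {f g h : L2} (hg : WeakDeriv f g) (hh : WeakDeriv f h) : g = h :=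
  toTemperedDistribution_injective (hg.trans hh.symm)

theorem weakDeriv_iff_integral {f g : L2} :
    WeakDeriv f g ↔ ∀ φ : 𝓢(ℝ, ℂ), ∫ x, φ x * g x = -∫ x, deriv φ x * f x := by
  unfold WeakDeriv
  have key : ∀ φ : 𝓢(ℝ, ℂ), (∂_{(1 : ℝ)} (f : 𝓢'(ℝ, ℂ))) φ = -∫ x, deriv φ x * f x := by
    intro φ
    rw [TemperedDistribution.lineDerivOp_apply_apply, map_neg, Lp.toTemperedDistribution_apply]
    congr 1
  constructor
  · intro h φ
    rw [← key, ← h, Lp.toTemperedDistribution_apply]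
    rfl
  · intro h
    ext φ
    rw [key, ← h, Lp.toTemperedDistribution_apply]
    rfl

/-- With differentiation as multiplication by `2πiξ`, the Sobolev estimates below reduce to
pointwise inequalities between weights. -/
theorem weakDeriv_iff_fourier {f g : L2} :
    WeakDeriv f g ↔
      (𝓕 g : L2) =ᵐ[volume] fun ξ => (2 * Real.pi * Complex.I * ξ) * (𝓕 f : L2) ξ := by
  have ht : (fun ξ : ℝ => (2 * Real.pi * Complex.I * ξ : ℂ)).HasTemperateGrowth := by fun_prop
  rw [← coe_eq_smulLeftCLM_iff ht, ← Lp.fourier_toTemperedDistribution_eq,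
    ← Lp.fourier_toTemperedDistribution_eq]
  have e : TemperedDistribution.smulLeftCLM ℂ (fun ξ : ℝ => (2 * Real.pi * Complex.I * ξ : ℂ))
      (𝓕 (f : 𝓢'(ℝ, ℂ))) = 𝓕 (∂_{(1 : ℝ)} (f : 𝓢'(ℝ, ℂ))) := by
    rw [TemperedDistribution.fourier_lineDerivOp_eq]
    have h2 : (fun ξ : ℝ => ((inner ℝ ξ (1 : ℝ) : ℝ) : ℂ)).HasTemperateGrowth := by fun_prop
    rw [← smul_apply, ← TemperedDistribution.smulLeftCLM_smul h2]
    congr 2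
    ext ξ
    simp
  rw [e]
  constructor
  · intro h
    rw [h]
  · intro h
    have := congrArg (fun u : 𝓢'(ℝ, ℂ) => 𝓕⁻ u) h
    simp only [FourierTransform.fourierInv_fourier_eq] at this
    exact this

/-- The weight of the `H^r` norm. -/
def bracket (r ξ : ℝ) : ℝ := (1 + (2 * Real.pi * ξ) ^ 2) ^ (r / 2)

theorem bracket_pos (r ξ : ℝ) : 0 < bracket r ξ := by unfold bracket; positivity

theorem continuous_bracket (r : ℝ) : Continuous (bracket r) := by
  unfold bracket
  refine Continuous.rpow_const (by fun_prop) fun x => Or.inl ?_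
  positivity

theorem bracket_mono {r s : ℝ} (h : r ≤ s) (ξ : ℝ) : bracket r ξ ≤ bracket s ξ := by
  unfold bracket
  refine Real.rpow_le_rpow_of_exponent_le ?_ (by linarith)
  nlinarith [sq_nonneg (2 * Real.pi * ξ)]

theorem bracket_one (ξ : ℝ) : bracket 1 ξ = Real.sqrt (1 + (2 * Real.pi * ξ) ^ 2) := by
  rw [bracket, Real.sqrt_eq_rpow]

theorem bracket_add (r s ξ : ℝ) : bracket (r + s) ξ = bracket r ξ * bracket s ξ := by
  unfold bracket
  rw [← Real.rpow_add (by positivity)]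
  congr 1; ring

theorem sobolevENorm_eq (r : ℝ) (f : L2) :
    sobolevENorm r f = eLpNorm (fun ξ : ℝ => (bracket r ξ : ℂ) * (𝓕 f : L2) ξ) 2 volume := rfl

theorem aestronglyMeasurable_bracket_mul (r : ℝ) (f : L2) :
    AEStronglyMeasurable (fun ξ : ℝ => (bracket r ξ : ℂ) * (𝓕 f : L2) ξ) volume :=
  (Complex.continuous_ofReal.comp (continuous_bracket r)).aestronglyMeasurable.mul
    (Lp.aestronglyMeasurable _)

/-- Membership is defined with the weight `(1 + ξ²)^{r/2}`, the norm with `(1 + (2πξ)²)^{r/2}`. For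
`r ≥ 0` their ratio lies between `1` and `(2π)^r`. -/
theorem mem_sobolev_iff {r : ℝ} (hr : 0 ≤ r) (f : L2) :
    f ∈ sobolev r ↔ sobolevENorm r f < ∞ := by
  have ht : (fun ξ : ℝ => (((1 + ‖ξ‖ ^ 2) ^ (r / 2) : ℝ) : ℂ)).HasTemperateGrowth := by fun_prop
  have hcont : Continuous (fun ξ : ℝ => (((1 + ‖ξ‖ ^ 2) ^ (r / 2) : ℝ) : ℂ)) := ht.1.continuous
  have h1 : f ∈ sobolev r ↔ MemLp (fun ξ : ℝ => (((1 + ‖ξ‖ ^ 2) ^ (r / 2) : ℝ) : ℂ) * (𝓕 f : L2) ξ)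
      2 volume := by
    change TemperedDistribution.MemSobolev r 2 (f : 𝓢'(ℝ, ℂ)) ↔ _
    rw [TemperedDistribution.memSobolev_iff_exists_smulLeftCLM_fourier]
    constructor
    · rintro ⟨v, hv⟩
      rw [Lp.fourier_toTemperedDistribution_eq] at hv
      exact (memLp_congr_ae ((coe_eq_smulLeftCLM_iff ht _ _).1 hv.symm)).1 (Lp.memLp v)
    · intro h
      refine ⟨h.toLp, ?_⟩
      rw [Lp.fourier_toTemperedDistribution_eq]
      exact ((coe_eq_smulLeftCLM_iff ht _ _).2 h.coeFn_toLp).symm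
  have hpi : (1 : ℝ) ≤ 2 * Real.pi := by linarith [Real.pi_gt_three]
  rw [h1, sobolevENorm_eq]
  constructor
  · intro h
    refine (MemLp.of_le_mul (c := (2 * Real.pi) ^ r) h (aestronglyMeasurable_bracket_mul r f)
      (Eventually.of_forall fun ξ => ?_)).2
    rw [norm_mul, norm_mul, Complex.norm_real, Complex.norm_real, ← mul_assoc,
      Real.norm_of_nonneg (bracket_pos r ξ).le, Real.norm_of_nonneg (by positivity)]
    gcongr
    have : (2 * Real.pi) ^ r = ((2 * Real.pi) ^ 2) ^ (r / 2) := by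
      rw [← Real.rpow_natCast, ← Real.rpow_mul (by positivity)]
      congr 1; push_cast; ring
    rw [this, ← Real.mul_rpow (by positivity) (by positivity), bracket]
    refine Real.rpow_le_rpow (by positivity) ?_ (by linarith)
    rw [Real.norm_eq_abs, sq_abs]
    nlinarith
  · intro h
    refine MemLp.of_le ⟨aestronglyMeasurable_bracket_mul r f, h⟩
      (hcont.aestronglyMeasurable.mul (Lp.aestronglyMeasurable _))
      (Eventually.of_forall fun ξ => ?_)
    rw [norm_mul, norm_mul, Complex.norm_real, Complex.norm_real,
      Real.norm_of_nonneg (bracket_pos r ξ).le, Real.norm_of_nonneg (by positivity)]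
    gcongr
    rw [bracket]
    refine Real.rpow_le_rpow (by positivity) ?_ (by linarith)
    rw [Real.norm_eq_abs, sq_abs, mul_pow]
    nlinarith [mul_nonneg (sub_nonneg.2 (one_le_pow₀ hpi : 1 ≤ (2 * Real.pi) ^ 2)) (sq_nonneg ξ)]

theorem sobolevENorm_zero_index (f : L2) : sobolevENorm 0 f = ‖f‖ₑ := by
  rw [sobolevENorm_eq]
  have : (fun ξ : ℝ => (bracket 0 ξ : ℂ) * (𝓕 f : L2) ξ) = (𝓕 f : L2) := by
    ext ξ
    simp [bracket]
  rw [this, ← Lp.enorm_def, ← ofReal_norm, Lp.norm_fourier_eq, ofReal_norm]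

theorem mem_sobolev_zero (f : L2) : f ∈ sobolev 0 := by
  rw [mem_sobolev_iff le_rfl, sobolevENorm_zero_index]
  exact enorm_lt_top

theorem sobolevENorm_mono {r s : ℝ} (h : r ≤ s) (f : L2) :
    sobolevENorm r f ≤ sobolevENorm s f := by
  rw [sobolevENorm_eq, sobolevENorm_eq]
  refine eLpNorm_mono fun ξ => ?_
  rw [norm_mul, norm_mul, Complex.norm_real, Complex.norm_real,
    Real.norm_of_nonneg (bracket_pos r ξ).le, Real.norm_of_nonneg (bracket_pos s ξ).le]
  gcongr
  exact bracket_mono h ξ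

theorem sobolev_mono {r s : ℝ} (h : r ≤ s) : sobolev s ≤ sobolev r :=
  fun _ hf => TemperedDistribution.MemSobolev.mono h hf

theorem enorm_le_sobolevENorm {r : ℝ} (hr : 0 ≤ r) (f : L2) : ‖f‖ₑ ≤ sobolevENorm r f := by
  rw [← sobolevENorm_zero_index]
  exact sobolevENorm_mono hr f

theorem fourier_add_ae (f g : L2) :
    (𝓕 (f + g) : L2) =ᵐ[volume] fun ξ => (𝓕 f : L2) ξ + (𝓕 g : L2) ξ := by
  rw [FourierTransform.fourier_add]
  exact Lp.coeFn_add _ _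

theorem fourier_smul_ae (a : ℂ) (f : L2) :
    (𝓕 (a • f) : L2) =ᵐ[volume] fun ξ => a * (𝓕 f : L2) ξ := by
  rw [FourierTransform.fourier_smul]
  exact Lp.coeFn_smul _ _

theorem sobolevENorm_add (r : ℝ) (f g : L2) :
    sobolevENorm r (f + g) ≤ sobolevENorm r f + sobolevENorm r g := by
  simp only [sobolevENorm_eq]
  refine le_trans (le_of_eq (eLpNorm_congr_ae ?_)) (eLpNorm_add_le
    (aestronglyMeasurable_bracket_mul r f) (aestronglyMeasurable_bracket_mul r g) (by norm_num))
  filter_upwards [fourier_add_ae f g] with ξ h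
  rw [h, Pi.add_apply, mul_add]

theorem sobolevENorm_smul (r : ℝ) (a : ℂ) (f : L2) :
    sobolevENorm r (a • f) = ‖a‖ₑ * sobolevENorm r f := by
  simp only [sobolevENorm_eq]
  rw [← eLpNorm_const_smul]
  refine eLpNorm_congr_ae ?_
  filter_upwards [fourier_smul_ae a f] with ξ h
  rw [h, Pi.smul_apply, smul_eq_mul]
  ring

theorem sobolevENorm_neg (r : ℝ) (f : L2) : sobolevENorm r (-f) = sobolevENorm r f := by
  rw [← neg_one_smul ℂ f, sobolevENorm_smul]
  simp

theorem sobolevENorm_sub (r : ℝ) (f g : L2) :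
    sobolevENorm r (f - g) ≤ sobolevENorm r f + sobolevENorm r g := by
  rw [sub_eq_add_neg, ← sobolevENorm_neg r g]
  exact sobolevENorm_add r f (-g)

theorem WeakDeriv.sobolevENorm_le {f g : L2} (h : WeakDeriv f g) (r : ℝ) :
    sobolevENorm r g ≤ sobolevENorm (r + 1) f := by
  simp only [sobolevENorm_eq]
  refine eLpNorm_mono_ae ?_
  filter_upwards [weakDeriv_iff_fourier.1 h] with ξ hξ
  rw [hξ, bracket_add]
  simp only [norm_mul, Complex.norm_real, Complex.norm_I, mul_one]
  rw [Real.norm_of_nonneg (bracket_pos r ξ).le, Real.norm_of_nonneg (bracket_pos 1 ξ).le,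
    ← mul_assoc]
  gcongr
  · exact (bracket_pos r ξ).le
  rw [bracket_one]
  refine Real.le_sqrt_of_sq_le ?_
  simp only [mul_pow, Complex.norm_ofNat, Real.norm_eq_abs, sq_abs]
  linarith

/-- From `√(1 + t²) ≤ 1 + |t|` with `t = 2πξ`. Together with `WeakDeriv.sobolevENorm_le` it allows
induction on the Sobolev order through weak derivatives alone. -/
theorem WeakDeriv.sobolevENorm_succ_le {f g : L2} (h : WeakDeriv f g) (r : ℝ) :
    sobolevENorm (r + 1) f ≤ sobolevENorm r f + sobolevENorm r g := by
  simp only [sobolevENorm_eq]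
  have e : ∀ u : L2, eLpNorm (fun ξ : ℝ => (bracket r ξ : ℂ) * (𝓕 u : L2) ξ) 2 volume =
      eLpNorm (fun ξ : ℝ => ‖(bracket r ξ : ℂ) * (𝓕 u : L2) ξ‖) 2 volume := fun u =>
    (eLpNorm_norm _).symm
  -- Passing to absolute values lets Minkowski's inequality be applied to a pointwise bound in which
  -- the phases of the two terms play no role.
  rw [e f, e g]
  refine le_trans ?_ (eLpNorm_add_le (aestronglyMeasurable_bracket_mul r f).norm
    (aestronglyMeasurable_bracket_mul r g).norm (by norm_num))
  refine eLpNorm_mono_ae ?_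
  filter_upwards [weakDeriv_iff_fourier.1 h] with ξ hξ
  rw [Pi.add_apply, hξ, bracket_add, Real.norm_of_nonneg (by positivity)]
  simp only [Complex.ofReal_mul, norm_mul, Complex.norm_real, Complex.norm_I, mul_one]
  rw [Real.norm_of_nonneg (bracket_pos r ξ).le, Real.norm_of_nonneg (bracket_pos 1 ξ).le]
  have : bracket 1 ξ ≤ 1 + 2 * |Real.pi| * |ξ| := by
    rw [bracket_one]
    refine Real.sqrt_le_iff.2 ⟨by positivity, ?_⟩
    have h1 : (2 * Real.pi * ξ) ^ 2 = (2 * |Real.pi| * |ξ|) ^ 2 := by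
      simp only [mul_pow, sq_abs]
    rw [h1]
    have : 0 ≤ 2 * |Real.pi| * |ξ| := by positivity
    nlinarith
  simp only [Complex.norm_ofNat, Real.norm_eq_abs]
  have h2 := mul_le_mul_of_nonneg_left this
    (mul_nonneg (bracket_pos r ξ).le (norm_nonneg ((𝓕 f : L2) ξ)))
  linarith

theorem exists_weakDeriv {r : ℝ} (hr : 1 ≤ r) {f : L2} (hf : f ∈ sobolev r) :
    ∃ g : L2, WeakDeriv f g := by
  have h₁ : TemperedDistribution.MemSobolev r 2 (f : 𝓢'(ℝ, ℂ)) := hf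
  obtain ⟨g, hg⟩ := TemperedDistribution.memSobolev_zero_iff.1
    ((h₁.lineDerivOp (m := (1 : ℝ))).mono (s' := 0) (by linarith))
  exact ⟨g, hg.symm⟩

open Classical in
/-- The weak derivative in `L²`, defined to be `0` if there is none. -/
def D (f : L2) : L2 := if h : ∃ g : L2, WeakDeriv f g then h.choose else 0

theorem WeakDeriv.D_eq {f g : L2} (h : WeakDeriv f g) : D f = g := by
  have h' : ∃ g : L2, WeakDeriv f g := ⟨g, h⟩
  rw [D, dif_pos h']
  exact h'.choose_spec.unique h

theorem weakDeriv_D {f : L2} (hf : f ∈ sobolev 1) : WeakDeriv f (D f) := by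
  obtain ⟨g, hg⟩ := exists_weakDeriv le_rfl hf
  rwa [hg.D_eq]

theorem WeakDeriv.mem_sobolev {r : ℝ} (hr : 0 ≤ r) {f g : L2} (h : WeakDeriv f g)
    (hf : f ∈ sobolev (r + 1)) : g ∈ sobolev r := by
  rw [mem_sobolev_iff hr]
  rw [mem_sobolev_iff (by linarith)] at hf
  exact (h.sobolevENorm_le r).trans_lt hf

theorem WeakDeriv.mem_sobolev_succ {r : ℝ} (hr : 0 ≤ r) {f g : L2} (h : WeakDeriv f g)
    (hf : f ∈ sobolev r) (hg : g ∈ sobolev r) : f ∈ sobolev (r + 1) := by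
  rw [mem_sobolev_iff (by linarith)]
  rw [mem_sobolev_iff hr] at hf hg
  exact (h.sobolevENorm_succ_le r).trans_lt (ENNReal.add_lt_top.2 ⟨hf, hg⟩)

theorem WeakDeriv.mem_sobolev_one {f g : L2} (h : WeakDeriv f g) : f ∈ sobolev 1 := by
  have := h.mem_sobolev_succ le_rfl (mem_sobolev_zero f) (mem_sobolev_zero g)
  rwa [zero_add] at this

theorem D_mem_sobolev {r : ℝ} (hr : 0 ≤ r) {f : L2} (hf : f ∈ sobolev (r + 1)) :
    D f ∈ sobolev r :=
  (weakDeriv_D (sobolev_mono (by linarith) hf)).mem_sobolev hr hf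

theorem D_mem_sobolev_one {f : L2} (hf : f ∈ sobolev 2) : D f ∈ sobolev 1 :=
  D_mem_sobolev zero_le_one (by norm_num; exact hf)

theorem sobolevENorm_D_le (r : ℝ) {f : L2} (hf : f ∈ sobolev 1) :
    sobolevENorm r (D f) ≤ sobolevENorm (r + 1) f :=
  (weakDeriv_D hf).sobolevENorm_le r

theorem WeakDeriv.add {f g f' g' : L2} (hf : WeakDeriv f f') (hg : WeakDeriv g g') :
    WeakDeriv (f + g) (f' + g') := by
  rw [weakDeriv_iff_fourier] at *
  filter_upwards [hf, hg, fourier_add_ae f g, fourier_add_ae f' g'] with ξ a b c d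
  rw [c, d, a, b, mul_add]

theorem WeakDeriv.smul {f f' : L2} (a : ℂ) (hf : WeakDeriv f f') :
    WeakDeriv (a • f) (a • f') := by
  rw [weakDeriv_iff_fourier] at *
  filter_upwards [hf, fourier_smul_ae a f, fourier_smul_ae a f'] with ξ h c d
  rw [c, d, h]
  ring

theorem secondDeriv_eq {f : L2} (hf : f ∈ sobolev 2) : secondDeriv f = D (D f) := by
  refine toTemperedDistribution_injective ?_
  rw [secondDeriv_spec le_rfl hf]
  have h1 : WeakDeriv f (D f) := weakDeriv_D (sobolev_mono (by norm_num) hf)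
  have h2 : WeakDeriv (D f) (D (D f)) := weakDeriv_D (D_mem_sobolev_one hf)
  unfold WeakDeriv at h1 h2
  rw [h2, h1]

/-! ### Functions all of whose derivatives are bounded -/

/-- `m` is `C^n` with bounded derivatives up to order `n`. -/
def BddDiff : ℕ → (ℝ → ℂ) → Prop
  | 0, m => Continuous m ∧ ∃ C : ℝ, ∀ x, ‖m x‖ ≤ C
  | n + 1, m => (∃ C : ℝ, ∀ x, ‖m x‖ ≤ C) ∧ Differentiable ℝ m ∧ BddDiff n (deriv m)

theorem BddDiff.bdd {n : ℕ} {m : ℝ → ℂ} (h : BddDiff n m) : ∃ C : ℝ, ∀ x, ‖m x‖ ≤ C := by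
  cases n with
  | zero => exact h.2
  | succ n => exact h.1

theorem BddDiff.continuous {n : ℕ} {m : ℝ → ℂ} (h : BddDiff n m) : Continuous m := by
  cases n with
  | zero => exact h.1
  | succ n => exact h.2.1.continuous

theorem BddDiff.of_succ {n : ℕ} {m : ℝ → ℂ} (h : BddDiff (n + 1) m) : BddDiff n m := by
  induction n generalizing m with
  | zero => exact ⟨h.continuous, h.bdd⟩
  | succ n ih => exact ⟨h.1, h.2.1, ih h.2.2⟩

/-- The induction step for functions solving a differential equation: when the derivative is an
expression in the function itself, bounds of order `n` give bounds of order `n + 1`. -/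
theorem BddDiff.succ_of_hasDerivAt {n : ℕ} {m m' : ℝ → ℂ} (hb : ∃ C : ℝ, ∀ x, ‖m x‖ ≤ C)
    (hd : ∀ x, HasDerivAt m (m' x) x) (h : BddDiff n m') : BddDiff (n + 1) m := by
  refine ⟨hb, fun x => (hd x).differentiableAt, ?_⟩
  rwa [show deriv m = m' from funext fun x => (hd x).deriv]

theorem BddDiff.hasDerivAt {n : ℕ} {m : ℝ → ℂ} (h : BddDiff (n + 1) m) (x : ℝ) :
    HasDerivAt m (deriv m x) x := (h.2.1 x).hasDerivAt

theorem BddDiff.add {n : ℕ} {m k : ℝ → ℂ} (hm : BddDiff n m) (hk : BddDiff n k) :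
    BddDiff n (fun x => m x + k x) := by
  have hb : ∃ C : ℝ, ∀ x, ‖m x + k x‖ ≤ C := by
    obtain ⟨C, hC⟩ := hm.bdd
    obtain ⟨C', hC'⟩ := hk.bdd
    exact ⟨C + C', fun x => (norm_add_le _ _).trans (add_le_add (hC x) (hC' x))⟩
  induction n generalizing m k with
  | zero => exact ⟨hm.1.add hk.1, hb⟩
  | succ n ih =>
    have hb' : ∃ C : ℝ, ∀ x, ‖deriv m x + deriv k x‖ ≤ C := by
      obtain ⟨C, hC⟩ := hm.2.2.bdd
      obtain ⟨C', hC'⟩ := hk.2.2.bdd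
      exact ⟨C + C', fun x => (norm_add_le _ _).trans (add_le_add (hC x) (hC' x))⟩
    exact BddDiff.succ_of_hasDerivAt hb (fun x => (hm.hasDerivAt x).add (hk.hasDerivAt x))
      (ih hm.2.2 hk.2.2 hb')

theorem BddDiff.mul {n : ℕ} {m k : ℝ → ℂ} (hm : BddDiff n m) (hk : BddDiff n k) :
    BddDiff n (fun x => m x * k x) := by
  have hb : ∀ {a b : ℝ → ℂ}, (∃ C : ℝ, ∀ x, ‖a x‖ ≤ C) → (∃ C : ℝ, ∀ x, ‖b x‖ ≤ C) →
      ∃ C : ℝ, ∀ x, ‖a x * b x‖ ≤ C := by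
    rintro a b ⟨C, hC⟩ ⟨C', hC'⟩
    refine ⟨C * C', fun x => ?_⟩
    rw [norm_mul]
    exact mul_le_mul (hC x) (hC' x) (norm_nonneg _) ((norm_nonneg _).trans (hC x))
  induction n generalizing m k with
  | zero => exact ⟨hm.1.mul hk.1, hb hm.2 hk.2⟩
  | succ n ih =>
    exact BddDiff.succ_of_hasDerivAt (hb hm.1 hk.1)
      (fun x => (hm.hasDerivAt x).mul (hk.hasDerivAt x))
      ((ih hm.2.2 hk.of_succ).add (ih hm.of_succ hk.2.2))

theorem bddDiff_const (n : ℕ) (a : ℂ) : BddDiff n (fun _ => a) := by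
  induction n generalizing a with
  | zero => exact ⟨continuous_const, ‖a‖, fun _ => le_rfl⟩
  | succ n ih =>
    exact BddDiff.succ_of_hasDerivAt ⟨‖a‖, fun _ => le_rfl⟩ (fun x => hasDerivAt_const x a) (ih 0)

theorem BddDiff.neg {n : ℕ} {m : ℝ → ℂ} (hm : BddDiff n m) : BddDiff n (fun x => -m x) := by
  simpa using (bddDiff_const n (-1)).mul hm

theorem BddDiff.sub {n : ℕ} {m k : ℝ → ℂ} (hm : BddDiff n m) (hk : BddDiff n k) :
    BddDiff n (fun x => m x - k x) := by
  simpa [sub_eq_add_neg] using hm.add hk.neg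

theorem BddDiff.comp_add_const {n : ℕ} {m : ℝ → ℂ} (hm : BddDiff n m) (a : ℝ) :
    BddDiff n (fun x => m (x + a)) := by
  have hb : ∃ C : ℝ, ∀ x, ‖m (x + a)‖ ≤ C := by
    obtain ⟨C, hC⟩ := hm.bdd
    exact ⟨C, fun x => hC _⟩
  induction n generalizing m with
  | zero => exact ⟨hm.1.comp (by fun_prop), hb⟩
  | succ n ih =>
    exact BddDiff.succ_of_hasDerivAt hb (fun x => (hm.hasDerivAt (x + a)).comp_add_const x a)
      (ih hm.2.2 (by obtain ⟨C, hC⟩ := hm.2.2.bdd; exact ⟨C, fun x => hC _⟩))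

/-- Smooth functions with bounded derivatives of all orders. -/
def BddSmooth (m : ℝ → ℂ) : Prop := ∀ n, BddDiff n m

namespace BddSmooth

variable {m k : ℝ → ℂ}

theorem continuous (h : BddSmooth m) : Continuous m := (h 0).continuous
theorem bdd (h : BddSmooth m) : ∃ C : ℝ, ∀ x, ‖m x‖ ≤ C := (h 0).bdd
theorem deriv (h : BddSmooth m) : BddSmooth (deriv m) := fun n => (h (n + 1)).2.2
theorem hasDerivAt (h : BddSmooth m) (x : ℝ) : HasDerivAt m (_root_.deriv m x) x :=
  (h 1).hasDerivAt x
theorem add (hm : BddSmooth m) (hk : BddSmooth k) : BddSmooth fun x => m x + k x :=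
  fun n => (hm n).add (hk n)
theorem sub (hm : BddSmooth m) (hk : BddSmooth k) : BddSmooth fun x => m x - k x :=
  fun n => (hm n).sub (hk n)
theorem mul (hm : BddSmooth m) (hk : BddSmooth k) : BddSmooth fun x => m x * k x :=
  fun n => (hm n).mul (hk n)
theorem const (a : ℂ) : BddSmooth fun _ => a := fun n => bddDiff_const n a

theorem contDiff (h : BddSmooth m) (n : ℕ) : ContDiff ℝ n m := by
  induction n generalizing m with
  | zero => exact contDiff_zero.2 h.continuous
  | succ n ih =>
    push_cast
    exact contDiff_succ_iff_deriv.2 ⟨(h 1).2.1, by simp, ih h.deriv⟩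

theorem bdd_iteratedDeriv (h : BddSmooth m) (n : ℕ) : ∃ C : ℝ, ∀ x, ‖iteratedDeriv n m x‖ ≤ C := by
  induction n generalizing m with
  | zero => simpa using h.bdd
  | succ n ih =>
    simp only [iteratedDeriv_succ']
    exact ih h.deriv

theorem hasTemperateGrowth (h : BddSmooth m) : m.HasTemperateGrowth := by
  refine ⟨contDiff_infty.2 h.contDiff, fun n => ?_⟩
  obtain ⟨C, hC⟩ := h.bdd_iteratedDeriv n
  refine ⟨0, C, fun x => ?_⟩
  rw [norm_iteratedFDeriv_eq_norm_iteratedDeriv]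
  simpa using hC x

theorem memLp_top (h : BddSmooth m) : MemLp m ∞ (volume : Measure ℝ) := by
  obtain ⟨C, hC⟩ := h.bdd
  exact memLp_top_of_bound h.continuous.aestronglyMeasurable C (Eventually.of_forall hC)

end BddSmooth

/-! ### Multiplication, translation and reflection on `L²` -/

theorem memLp_mul {m : ℝ → ℂ} (hm : BddSmooth m) (f : L2) :
    MemLp (fun x => m x * f x) 2 (volume : Measure ℝ) :=
  (Lp.memLp f).mul hm.memLp_top

open Classical in
/-- Multiplication by a bounded smooth function. -/
def mulL (m : ℝ → ℂ) (f : L2) : L2 :=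
  if h : MemLp (fun x => m x * f x) 2 (volume : Measure ℝ) then h.toLp else 0

theorem mulL_ae {m : ℝ → ℂ} (hm : BddSmooth m) (f : L2) :
    mulL m f =ᵐ[volume] fun x => m x * f x := by
  rw [mulL, dif_pos (memLp_mul hm f)]
  exact MemLp.coeFn_toLp _

theorem mulL_add {m : ℝ → ℂ} (hm : BddSmooth m) (f g : L2) :
    mulL m (f + g) = mulL m f + mulL m g := by
  ext1
  filter_upwards [mulL_ae hm f, mulL_ae hm g, mulL_ae hm (f + g), Lp.coeFn_add f g,
    Lp.coeFn_add (mulL m f) (mulL m g)] with x a b c d e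
  rw [c, d, e, Pi.add_apply, Pi.add_apply, a, b, mul_add]

theorem mulL_smul {m : ℝ → ℂ} (hm : BddSmooth m) (a : ℂ) (f : L2) :
    mulL m (a • f) = a • mulL m f := by
  ext1
  filter_upwards [mulL_ae hm f, mulL_ae hm (a • f), Lp.coeFn_smul a f,
    Lp.coeFn_smul a (mulL m f)] with x b c d e
  rw [c, d, e, Pi.smul_apply, Pi.smul_apply, b, smul_eq_mul, smul_eq_mul]
  ring

theorem mulL_sub {m : ℝ → ℂ} (hm : BddSmooth m) (f g : L2) :
    mulL m (f - g) = mulL m f - mulL m g := by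
  have := mulL_add hm f ((-1 : ℂ) • g)
  rw [mulL_smul hm] at this
  simpa [sub_eq_add_neg] using this

theorem mulL_mulL {m k : ℝ → ℂ} (hm : BddSmooth m) (hk : BddSmooth k) (f : L2) :
    mulL m (mulL k f) = mulL (fun x => m x * k x) f := by
  ext1
  filter_upwards [mulL_ae hm (mulL k f), mulL_ae hk f, mulL_ae (hm.mul hk) f] with x a b c
  rw [a, b, c, mul_assoc]

theorem norm_mulL_le {m : ℝ → ℂ} (hm : BddSmooth m) {C : ℝ} (hC : ∀ x, ‖m x‖ ≤ C) (f : L2) :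
    ‖mulL m f‖ ≤ C * ‖f‖ := by
  refine Lp.norm_le_mul_norm_of_ae_le_mul ?_
  filter_upwards [mulL_ae hm f] with x a
  rw [a, norm_mul]
  gcongr
  exact hC x

/-- Translation `f ↦ f(· + a)`. -/
def shift (a : ℝ) : L2 →ₗᵢ[ℂ] L2 :=
  Lp.compMeasurePreservingₗᵢ ℂ (fun x => x + a) (measurePreserving_add_right volume a)

theorem shift_ae (a : ℝ) (f : L2) : shift a f =ᵐ[volume] fun x => f (x + a) :=
  Lp.coeFn_compMeasurePreserving f (measurePreserving_add_right volume a)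

/-- Reflection `f ↦ f(-·)`. -/
def refl : L2 →ₗᵢ[ℂ] L2 :=
  Lp.compMeasurePreservingₗᵢ ℂ (fun x => -x) (Measure.measurePreserving_neg volume)

theorem refl_ae (f : L2) : refl f =ᵐ[volume] fun x => f (-x) :=
  Lp.coeFn_compMeasurePreserving f (Measure.measurePreserving_neg volume)

theorem mem_evenL2_iff (f : L2) : f ∈ evenL2 ↔ refl f = f := by
  change (∀ᵐ x : ℝ, f (-x) = f x) ↔ _
  rw [Lp.ext_iff]
  constructor
  · intro h
    filter_upwards [h, refl_ae f] with x a b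
    rw [b, a]
  · intro h
    filter_upwards [h, refl_ae f] with x a b
    rw [← a, b]

theorem ae_add_const {p : ℝ → Prop} (a : ℝ) (h : ∀ᵐ x : ℝ, p x) : ∀ᵐ x : ℝ, p (x + a) :=
  (measurePreserving_add_right (volume : Measure ℝ) a).quasiMeasurePreserving.ae h

theorem ae_neg {p : ℝ → Prop} (h : ∀ᵐ x : ℝ, p x) : ∀ᵐ x : ℝ, p (-x) :=
  (Measure.measurePreserving_neg (volume : Measure ℝ)).quasiMeasurePreserving.ae h

/-- Leibniz rule: `m φ` is again a Schwartz function, so the weak derivative of `f` may be tested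
against it. -/
theorem WeakDeriv.mulL {m : ℝ → ℂ} (hm : BddSmooth m) {f g : L2} (h : WeakDeriv f g) :
    WeakDeriv (mulL m f) (mulL m g + MonatomicFPUT.mulL (deriv m) f) := by
  rw [weakDeriv_iff_integral] at *
  intro φ
  have h1 := h (SchwartzMap.smulLeftCLM ℂ m φ)
  have e1 : ∀ x, (SchwartzMap.smulLeftCLM ℂ m φ) x = m x * φ x := fun x => by
    rw [SchwartzMap.smulLeftCLM_apply_apply hm.hasTemperateGrowth, smul_eq_mul]
  have e2 : ∀ x, deriv (SchwartzMap.smulLeftCLM ℂ m φ) x = deriv m x * φ x + m x * deriv φ x := by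
    intro x
    have : (SchwartzMap.smulLeftCLM ℂ m φ : ℝ → ℂ) = fun x => m x * φ x := funext e1
    rw [this]
    exact ((hm.hasDerivAt x).mul (φ.differentiableAt.hasDerivAt)).deriv
  simp only [e1, e2] at h1
  have i0 : ∀ (ψ : 𝓢(ℝ, ℂ)) (u : L2), Integrable (fun x => ψ x * u x) := fun ψ u =>
    MemLp.integrable_mul (ψ.memLp 2 volume) (Lp.memLp u)
  have i1 : Integrable (fun x => φ x * (MonatomicFPUT.mulL m g) x) := i0 _ _
  have i2 : Integrable (fun x => φ x * (MonatomicFPUT.mulL (deriv m) f) x) := i0 _ _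
  have i3 : Integrable (fun x => deriv φ x * (MonatomicFPUT.mulL m f) x) :=
    i0 (SchwartzMap.derivCLM ℂ ℂ φ) _
  have a1 : ∫ x, φ x * (MonatomicFPUT.mulL m g + MonatomicFPUT.mulL (deriv m) f : L2) x =
      ∫ x, φ x * (MonatomicFPUT.mulL m g) x + φ x * (MonatomicFPUT.mulL (deriv m) f) x := by
    refine integral_congr_ae ?_
    filter_upwards [Lp.coeFn_add (MonatomicFPUT.mulL m g) (MonatomicFPUT.mulL (deriv m) f)]
      with x hx
    rw [hx, Pi.add_apply, mul_add]
  have a2 : ∫ x, m x * φ x * g x = ∫ x, φ x * (MonatomicFPUT.mulL m g) x := by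
    refine integral_congr_ae ?_
    filter_upwards [mulL_ae hm g] with x hx
    rw [hx]; ring
  have a3 : ∫ x, (deriv m x * φ x + m x * deriv φ x) * f x =
      ∫ x, φ x * (MonatomicFPUT.mulL (deriv m) f) x + deriv φ x * (MonatomicFPUT.mulL m f) x := by
    refine integral_congr_ae ?_
    filter_upwards [mulL_ae hm f, mulL_ae hm.deriv f] with x hx hx'
    rw [hx, hx']; ring
  rw [a2, a3, integral_add i2 i3] at h1
  rw [a1, integral_add i1 i2, h1]
  ring

/-- A Schwartz function composed with a translation. -/
def schwartzShift (a : ℝ) (φ : 𝓢(ℝ, ℂ)) : 𝓢(ℝ, ℂ) :=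
  SchwartzMap.compCLMOfAntilipschitz ℂ (g := fun x : ℝ => x + a) (K := 1)
    (by fun_prop) (AntilipschitzWith.of_le_mul_dist fun x y => by simp) φ

theorem WeakDeriv.shift (a : ℝ) {f g : L2} (h : WeakDeriv f g) :
    WeakDeriv (shift a f) (shift a g) := by
  rw [weakDeriv_iff_integral] at *
  intro φ
  have h1 := h (schwartzShift (-a) φ)
  have e1 : ∀ x, schwartzShift (-a) φ x = φ (x + -a) := fun x => rfl
  have e2 : ∀ x, deriv (schwartzShift (-a) φ) x = deriv φ (x + -a) := fun x => by
    rw [show (schwartzShift (-a) φ : ℝ → ℂ) = fun x => φ (x + -a) from funext e1]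
    exact deriv_comp_add_const ..
  simp only [e1, e2] at h1
  rw [← integral_add_right_eq_self _ a, ← integral_add_right_eq_self (fun x => _ * f x) a] at h1
  simp only [add_neg_cancel_right] at h1
  rw [integral_congr_ae (g := fun x => φ x * g (x + a)), h1, neg_inj]
  · refine integral_congr_ae ?_
    filter_upwards [shift_ae a f] with x hx
    rw [hx]
  · filter_upwards [shift_ae a g] with x hx
    rw [hx]

theorem WeakDeriv.refl {f g : L2} (h : WeakDeriv f g) :
    WeakDeriv (refl f) (-refl g) := by
  rw [weakDeriv_iff_integral] at *
  intro φ
  let ψ : 𝓢(ℝ, ℂ) := SchwartzMap.compCLMOfAntilipschitz ℂ (g := fun x : ℝ => -x) (K := 1)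
    (by fun_prop) (AntilipschitzWith.of_le_mul_dist fun x y => by simp) φ
  have h1 := h ψ
  have e1 : ∀ x, ψ x = φ (-x) := fun x => rfl
  have e2 : ∀ x, deriv ψ x = -deriv φ (-x) := fun x => by
    rw [show (ψ : ℝ → ℂ) = fun x => φ (-x) from funext e1]
    exact deriv_comp_neg ..
  simp only [e1, e2] at h1
  rw [← integral_neg_eq_self, ← integral_neg_eq_self (fun x => _ * f x)] at h1
  simp only [neg_neg] at h1
  rw [integral_congr_ae (g := fun x => -(φ x * g (-x))), integral_neg, h1, ← integral_neg,
    ← integral_neg, ← integral_neg]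
  · refine integral_congr_ae ?_
    filter_upwards [refl_ae f] with x hx
    rw [hx]; ring
  · filter_upwards [refl_ae g, Lp.coeFn_neg (MonatomicFPUT.refl g)] with x hx hx'
    rw [hx', Pi.neg_apply, hx]; ring

theorem weakDeriv_of_sobolev_succ {n : ℕ} {f : L2} (hf : f ∈ sobolev ((n + 1 : ℕ) : ℝ)) :
    WeakDeriv f (D f) ∧ D f ∈ sobolev (n : ℝ) := by
  have h1 : f ∈ sobolev 1 := sobolev_mono (by push_cast; linarith [n.cast_nonneg (α := ℝ)]) hf
  refine ⟨weakDeriv_D h1, D_mem_sobolev n.cast_nonneg ?_⟩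
  rwa [← Nat.cast_succ]

/-- Induction on the order by the Leibniz rule, hence only for integer orders. Real orders are later
placed between consecutive integers. -/
theorem mulL_sobolev {m : ℝ → ℂ} (hm : BddSmooth m) (n : ℕ) :
    ∃ C : ℝ≥0, ∀ f ∈ sobolev (n : ℝ), mulL m f ∈ sobolev (n : ℝ) ∧
      sobolevENorm n (mulL m f) ≤ C * sobolevENorm n f := by
  suffices H : ∃ C : ℝ≥0, ∀ f ∈ sobolev (n : ℝ),
      sobolevENorm n (mulL m f) ≤ C * sobolevENorm n f by
    obtain ⟨C, hC⟩ := H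
    refine ⟨C, fun f hf => ⟨?_, hC f hf⟩⟩
    rw [mem_sobolev_iff n.cast_nonneg] at hf ⊢
    refine (hC f ((mem_sobolev_iff n.cast_nonneg f).2 hf)).trans_lt
      (ENNReal.mul_lt_top ENNReal.coe_lt_top hf)
  induction n generalizing m with
  | zero =>
    obtain ⟨C, hC⟩ := hm.bdd
    have hC0 : 0 ≤ C := (norm_nonneg _).trans (hC 0)
    refine ⟨C.toNNReal, fun f _ => ?_⟩
    simp only [Nat.cast_zero, sobolevENorm_zero_index]
    have := norm_mulL_le hm hC f
    change _ ≤ ENNReal.ofReal C * _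
    rw [← ofReal_norm, ← ofReal_norm, ← ENNReal.ofReal_mul hC0]
    exact ENNReal.ofReal_le_ofReal this
  | succ n ih =>
    obtain ⟨C₁, h₁⟩ := ih hm
    obtain ⟨C₂, h₂⟩ := ih hm.deriv
    refine ⟨2 * C₁ + C₂, fun f hf => ?_⟩
    obtain ⟨hd, hDf⟩ := weakDeriv_of_sobolev_succ hf
    have hfn : f ∈ sobolev (n : ℝ) := sobolev_mono (by push_cast; linarith) hf
    have k1 : sobolevENorm n f ≤ sobolevENorm (n + 1 : ℕ) f :=
      sobolevENorm_mono (by push_cast; linarith) f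
    have k2 : sobolevENorm n (D f) ≤ sobolevENorm (n + 1 : ℕ) f := by
      push_cast
      exact hd.sobolevENorm_le n
    calc sobolevENorm (n + 1 : ℕ) (mulL m f)
        ≤ sobolevENorm n (mulL m f) + sobolevENorm n (mulL m (D f) + mulL (deriv m) f) := by
          push_cast
          exact (hd.mulL hm).sobolevENorm_succ_le n
      _ ≤ sobolevENorm n (mulL m f) + (sobolevENorm n (mulL m (D f)) +
          sobolevENorm n (mulL (deriv m) f)) := by gcongr; exact sobolevENorm_add _ _ _
      _ ≤ C₁ * sobolevENorm n f + (C₁ * sobolevENorm n (D f) + C₂ * sobolevENorm n f) := by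
          gcongr
          · exact h₁ f hfn
          · exact h₁ _ hDf
          · exact h₂ f hfn
      _ ≤ C₁ * sobolevENorm (n + 1 : ℕ) f + (C₁ * sobolevENorm (n + 1 : ℕ) f +
          C₂ * sobolevENorm (n + 1 : ℕ) f) := by gcongr
      _ = (2 * C₁ + C₂ : ℝ≥0) * sobolevENorm (n + 1 : ℕ) f := by
          push_cast; ring

theorem shift_sobolev (a : ℝ) (n : ℕ) :
    ∃ C : ℝ≥0, ∀ f ∈ sobolev (n : ℝ), shift a f ∈ sobolev (n : ℝ) ∧
      sobolevENorm n (shift a f) ≤ C * sobolevENorm n f := by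
  suffices H : ∃ C : ℝ≥0, ∀ f ∈ sobolev (n : ℝ),
      sobolevENorm n (shift a f) ≤ C * sobolevENorm n f by
    obtain ⟨C, hC⟩ := H
    refine ⟨C, fun f hf => ⟨?_, hC f hf⟩⟩
    rw [mem_sobolev_iff n.cast_nonneg] at hf ⊢
    refine (hC f ((mem_sobolev_iff n.cast_nonneg f).2 hf)).trans_lt
      (ENNReal.mul_lt_top ENNReal.coe_lt_top hf)
  induction n with
  | zero =>
    refine ⟨1, fun f _ => ?_⟩
    simp only [Nat.cast_zero, sobolevENorm_zero_index]
    rw [← ofReal_norm, ← ofReal_norm, LinearIsometry.norm_map]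
    simp
  | succ n ih =>
    obtain ⟨C₁, h₁⟩ := ih
    refine ⟨2 * C₁, fun f hf => ?_⟩
    obtain ⟨hd, hDf⟩ := weakDeriv_of_sobolev_succ hf
    have hfn : f ∈ sobolev (n : ℝ) := sobolev_mono (by push_cast; linarith) hf
    have k1 : sobolevENorm n f ≤ sobolevENorm (n + 1 : ℕ) f :=
      sobolevENorm_mono (by push_cast; linarith) f
    have k2 : sobolevENorm n (D f) ≤ sobolevENorm (n + 1 : ℕ) f := by
      push_cast
      exact hd.sobolevENorm_le n
    calc sobolevENorm (n + 1 : ℕ) (shift a f)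
        ≤ sobolevENorm n (shift a f) + sobolevENorm n (shift a (D f)) := by
          push_cast
          exact (hd.shift a).sobolevENorm_succ_le n
      _ ≤ C₁ * sobolevENorm n f + C₁ * sobolevENorm n (D f) := by
          gcongr
          · exact h₁ f hfn
          · exact h₁ _ hDf
      _ ≤ C₁ * sobolevENorm (n + 1 : ℕ) f + C₁ * sobolevENorm (n + 1 : ℕ) f := by gcongr
      _ = (2 * C₁ : ℝ≥0) * sobolevENorm (n + 1 : ℕ) f := by
          push_cast; ring

/-! ### Regularity of the travelling wave -/

/-- Sobolev embedding: functions in `H¹` are bounded and continuous. -/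
theorem exists_bdd_continuous_rep {f : L2} (hf : f ∈ sobolev 1) :
    ∃ s : ℝ → ℂ, Continuous s ∧ (∃ C : ℝ, ∀ x, ‖s x‖ ≤ C) ∧ f =ᵐ[volume] s := by
  -- Since `1 > 1/2`, half the dimension, the Fourier transform of an `H¹` function is integrable.
  obtain ⟨v, hv⟩ := TemperedDistribution.MemSobolev.fourier_memL1 (s := 1) (by simp)
    (show TemperedDistribution.MemSobolev 1 2 (f : 𝓢'(ℝ, ℂ)) from hf)
  have hvi : Integrable v (volume : Measure ℝ) := L1.integrable_coeFn v
  -- The sign makes the Fourier integral for this pairing the inverse transform, so `s` below is the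
  -- inverse transform of `v`.
  let L : ℝ →ₗ[ℝ] ℝ →ₗ[ℝ] ℝ := -innerₗ ℝ
  have hL : Continuous fun p : ℝ × ℝ => L p.1 p.2 := by
    simp only [L, LinearMap.neg_apply, innerₗ_apply_apply]
    fun_prop
  have hL' : Continuous fun p : ℝ × ℝ => L.flip p.1 p.2 := by
    simp only [L, LinearMap.flip_apply, LinearMap.neg_apply, innerₗ_apply_apply]
    fun_prop
  let s : ℝ → ℂ := VectorFourier.fourierIntegral Real.fourierChar volume L.flip v
  have hs : Continuous s :=
    VectorFourier.fourierIntegral_continuous Real.continuous_fourierChar hL' hvi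
  refine ⟨s, hs, ⟨_, VectorFourier.norm_fourierIntegral_le_integral_norm _ _ _ _⟩, ?_⟩
  refine ae_eq_of_integral_contDiff_smul_eq (L2.locallyIntegrable f) hs.locallyIntegrable ?_
  intro g g_smooth g_cpt
  have hg₁ : HasCompactSupport (Complex.ofRealCLM ∘ g) := g_cpt.comp_left rfl
  have hg₂ : ContDiff ℝ ((⊤ : ℕ∞) : WithTop ℕ∞) (Complex.ofRealCLM ∘ g) := by fun_prop
  set φ : 𝓢(ℝ, ℂ) := hg₁.toSchwartzMap hg₂
  have e1 : ∀ x, φ x = (g x : ℂ) := fun x => rfl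
  have h1 : (𝓕 (f : 𝓢'(ℝ, ℂ))) (𝓕⁻ φ) = ∫ x, g x • f x := by
    rw [TemperedDistribution.fourier_apply, FourierTransform.fourier_fourierInv_eq,
      Lp.toTemperedDistribution_apply]
    rfl
  rw [← h1, hv, Lp.toTemperedDistribution_apply, SchwartzMap.fourierInv_coe]
  exact VectorFourier.integral_fourierIntegral_smul_eq_flip (L := L) (f := φ) (g := v)
    Real.continuous_fourierChar hL φ.integrable hvi

/-- The du Bois-Reymond lemma for continuous functions. -/
theorem eq_const_of_integral_deriv_mul_eq_zero {u : ℝ → ℂ} (hu : Continuous u)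
    (h : ∀ φ : ℝ → ℝ, ContDiff ℝ ((⊤ : ℕ∞) : WithTop ℕ∞) φ → HasCompactSupport φ →
      ∫ x, deriv φ x • u x = 0) : ∃ a : ℂ, ∀ x, u x = a := by
  let b : ContDiffBump (0 : ℝ) := ⟨1, 2, by norm_num, by norm_num⟩
  let η : ℝ → ℝ := b.normed volume
  have hη : ContDiff ℝ ((⊤ : ℕ∞) : WithTop ℕ∞) η := b.contDiff_normed
  have hηc : HasCompactSupport η := b.hasCompactSupport_normed
  have hη1 : ∫ x, η x = 1 := b.integral_normed
  refine ⟨∫ x, η x • u x, fun x => ?_⟩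
  have hae : u =ᵐ[volume] fun _ => ∫ x, η x • u x := by
    refine ae_eq_of_integral_contDiff_smul_eq hu.locallyIntegrable
      continuous_const.locallyIntegrable ?_
    intro ψ hψ hψc
    -- Subtracting a multiple of the normalized bump gives total integral zero, so the primitive of
    -- `κ` has compact support and is an admissible test function.
    set κ : ℝ → ℝ := fun x => ψ x - (∫ y, ψ y) * η x with hκ
    have hκs : ContDiff ℝ ((⊤ : ℕ∞) : WithTop ℕ∞) κ := hψ.sub (contDiff_const.mul hη)
    have hψi : Integrable ψ := hψ.continuous.integrable_of_hasCompactSupport hψc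
    have hηi : Integrable η := hη.continuous.integrable_of_hasCompactSupport hηc
    have hκ0 : ∫ x, κ x = 0 := by
      rw [hκ, integral_sub hψi (hηi.const_mul _), integral_const_mul, hη1]
      ring
    have hκc : HasCompactSupport κ := hψc.sub (hηc.mul_left)
    obtain ⟨R, hR0, hR⟩ := hκc.isCompact.isBounded.subset_closedBall_lt 0 (0 : ℝ)
    have hz : ∀ x, R < |x| → κ x = 0 := fun x hx => by
      by_contra h0
      have := hR (subset_tsupport κ h0)
      rw [mem_closedBall_zero_iff, Real.norm_eq_abs] at this
      linarith
    set φ : ℝ → ℝ := fun x => ∫ t in (-R)..x, κ t with hφ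
    have hd : ∀ x, HasDerivAt φ (κ x) x := fun x =>
      intervalIntegral.integral_hasDerivAt_right (hκs.continuous.intervalIntegrable _ _)
        (hκs.continuous.stronglyMeasurableAtFilter _ _) hκs.continuous.continuousAt
    have hdφ : deriv φ = κ := funext fun x => (hd x).deriv
    have hφs : ContDiff ℝ ((⊤ : ℕ∞) : WithTop ℕ∞) φ :=
      contDiff_infty_iff_deriv.2 ⟨fun x => (hd x).differentiableAt, hdφ ▸ hκs⟩
    have hφc : HasCompactSupport φ := by
      refine HasCompactSupport.intro (isCompact_Icc (a := -R) (b := R)) fun x hx => ?_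
      have hκR : ∫ t in (-R)..R, κ t = 0 := by
        rw [intervalIntegral.integral_of_le (by linarith), ← integral_Icc_eq_integral_Ioc,
          setIntegral_eq_integral_of_forall_compl_eq_zero, hκ0]
        intro t ht
        refine hz t ?_
        by_contra hc
        exact ht (abs_le.1 (not_lt.1 hc))
      rw [Set.mem_Icc, not_and_or, not_le, not_le] at hx
      rcases hx with hx | hx
      · rw [hφ]
        refine (intervalIntegral.integral_congr_ae (g := fun _ => (0 : ℝ)) ?_).trans (by simp)
        rw [Set.uIoc_of_ge hx.le]
        filter_upwards [Measure.ae_ne volume (-R)] with t hne ht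
        refine hz t ?_
        have : t < -R := lt_of_le_of_ne ht.2 hne
        rw [abs_of_neg (by linarith)]
        linarith
      · rw [hφ]
        change ∫ t in (-R)..x, κ t = 0
        rw [← intervalIntegral.integral_add_adjacent_intervals
          (hκs.continuous.intervalIntegrable (-R) R) (hκs.continuous.intervalIntegrable R x), hκR,
          zero_add]
        refine (intervalIntegral.integral_congr_ae (g := fun _ => (0 : ℝ)) ?_).trans (by simp)
        rw [Set.uIoc_of_le hx.le]
        refine Eventually.of_forall fun t ht => hz t ?_
        rw [abs_of_pos (by linarith [ht.1])]
        exact ht.1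
    have h0 := h φ hφs hφc
    rw [hdφ] at h0
    have i1 : Integrable fun x => ψ x • u x :=
      (hψ.continuous.smul hu).integrable_of_hasCompactSupport hψc.smul_right
    have i2 : Integrable fun x => η x • u x :=
      (hη.continuous.smul hu).integrable_of_hasCompactSupport hηc.smul_right
    have : ∀ x, κ x • u x = ψ x • u x - (∫ y, ψ y) • (η x • u x) := fun x => by
      rw [hκ, sub_smul, mul_smul]
    simp only [this] at h0
    rw [integral_sub i1 (by exact i2.smul (∫ y, ψ y)), integral_smul, sub_eq_zero] at h0
    rw [h0, integral_smul_const]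
  exact congrFun ((hu.ae_eq_iff_eq volume continuous_const).1 hae) x

/-- The difference of `s` and a primitive of `p` has zero weak derivative, so it is constant by the
du Bois-Reymond lemma. -/
theorem hasDerivAt_of_weakDeriv {f g : L2} (h : WeakDeriv f g) {s p : ℝ → ℂ}
    (hs : Continuous s) (hp : Continuous p) (hfs : f =ᵐ[volume] s) (hgp : g =ᵐ[volume] p) (x : ℝ) :
    HasDerivAt s (p x) x := by
  set P : ℝ → ℂ := fun x => ∫ t in (0 : ℝ)..x, p t with hP
  have hPd : ∀ x, HasDerivAt P (p x) x := fun x =>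
    intervalIntegral.integral_hasDerivAt_right (hp.intervalIntegrable _ _)
      (hp.stronglyMeasurableAtFilter _ _) hp.continuousAt
  have hPc : Continuous P := continuous_iff_continuousAt.2 fun x => (hPd x).continuousAt
  obtain ⟨a, ha⟩ := eq_const_of_integral_deriv_mul_eq_zero (u := fun x => s x - P x)
    (hs.sub hPc) (by
    intro g' g_smooth g_cpt
    have hg₁ : HasCompactSupport (Complex.ofRealCLM ∘ g') := g_cpt.comp_left rfl
    have hg₂ : ContDiff ℝ ((⊤ : ℕ∞) : WithTop ℕ∞) (Complex.ofRealCLM ∘ g') := by fun_prop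
    set φ : 𝓢(ℝ, ℂ) := hg₁.toSchwartzMap hg₂
    have e1 : ∀ x, φ x = (g' x : ℂ) := fun x => rfl
    have hdg : ∀ x, HasDerivAt g' (deriv g' x) x := fun x =>
      (g_smooth.differentiable (by simp) x).hasDerivAt
    have hdc : Continuous (deriv g') := g_smooth.continuous_deriv (by simp)
    have e3 : ∀ x, HasDerivAt φ ((deriv g' x : ℝ) : ℂ) x := fun x => (hdg x).ofReal_comp
    have e2 : ∀ x, deriv φ x = ((deriv g' x : ℝ) : ℂ) := fun x => (e3 x).deriv
    have h1 := weakDeriv_iff_integral.1 h φ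
    rw [integral_congr_ae (g := fun x => g' x • p x)
      (by filter_upwards [hgp] with x hx; rw [hx, e1]; rfl),
      integral_congr_ae (f := fun x => deriv φ x * f x) (g := fun x => deriv g' x • s x)
      (by filter_upwards [hfs] with x hx; rw [hx, e2]; rfl)] at h1
    have i1 : Integrable fun x => g' x • p x :=
      (g_smooth.continuous.smul hp).integrable_of_hasCompactSupport g_cpt.smul_right
    have i2 : Integrable fun x => deriv g' x • P x :=
      (hdc.smul hPc).integrable_of_hasCompactSupport g_cpt.deriv.smul_right
    have i3 : Integrable fun x => g' x • P x :=
      (g_smooth.continuous.smul hPc).integrable_of_hasCompactSupport g_cpt.smul_right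
    have i4 : Integrable fun x => deriv g' x • s x :=
      (hdc.smul hs).integrable_of_hasCompactSupport g_cpt.deriv.smul_right
    have h2 := integral_mul_deriv_eq_deriv_mul_of_integrable (u := φ) (v := P)
      (u' := fun x => ((deriv g' x : ℝ) : ℂ)) (v' := p) (fun x _ => e3 x) (fun x _ => hPd x) i1 i2 i3
    have h3 : ∫ x, g' x • p x = -∫ x, deriv g' x • P x := h2
    simp only [smul_sub]
    rw [integral_sub i4 i2, sub_eq_zero, ← neg_inj, ← h1, h3])
  have : s = fun x => a + P x := funext fun x => by rw [← ha x]; ring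
  rw [this]
  exact (hPd x).const_add a

/-- The equation gives `s' = p` and `p' = -c⁻² (2 - A)(s + s²)`, whose right-hand sides involve no
derivatives. Hence `s` and `p` gain regularity together, one order at a time. -/
theorem exists_bddSmooth_rep {c : ℝ} (hc : c ≠ 0) {ς : L2} (h2 : ς ∈ sobolev 2) (he : ς ∈ evenL2)
    (hw : IsTravelingWave c ς) :
    ∃ s : ℝ → ℂ, BddSmooth s ∧ ς =ᵐ[volume] s ∧ ∀ x, s (-x) = s x := by
  have h1 : ς ∈ sobolev 1 := sobolev_mono (by norm_num) h2
  obtain ⟨s, hs, hsb, hss⟩ := exists_bdd_continuous_rep h1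
  obtain ⟨p, hp, hpb, hpp⟩ := exists_bdd_continuous_rep (D_mem_sobolev_one h2)
  have hsp : ∀ x, HasDerivAt s (p x) x :=
    hasDerivAt_of_weakDeriv (weakDeriv_D h1) hs hp hss hpp
  set n : ℝ → ℂ := fun x => s x + s x * s x with hn
  set θ : ℝ → ℂ := fun x => (-1 / (c : ℂ) ^ 2) * (2 * n x - (n (x + 1) + n (x + -1))) with hθ
  have hcC : (c : ℂ) ≠ 0 := by exact_mod_cast hc
  have hθae : D (D ς) =ᵐ[volume] θ := by
    rw [← secondDeriv_eq h2]
    filter_upwards [hw, hss, ae_add_const 1 hss, ae_add_const (-1) hss] with x a b d e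
    simp only [twoSubA, sub_eq_add_neg x 1] at a
    rw [b, d, e] at a
    simp only [hθ, hn]
    field_simp
    linear_combination a
  have hnc : Continuous n := hs.add (hs.mul hs)
  have hθc : Continuous θ := by
    have a1 : Continuous fun x => n (x + 1) := hnc.comp (by fun_prop)
    have a2 : Continuous fun x => n (x + -1) := hnc.comp (by fun_prop)
    exact continuous_const.mul ((continuous_const.mul hnc).sub (a1.add a2))
  have hpθ : ∀ x, HasDerivAt p (θ x) x :=
    hasDerivAt_of_weakDeriv (weakDeriv_D (D_mem_sobolev_one h2)) hp hθc hpp hθae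
  have key : ∀ k, BddDiff k s ∧ BddDiff k p := by
    intro k
    induction k with
    | zero => exact ⟨⟨hs, hsb⟩, ⟨hp, hpb⟩⟩
    | succ k ih =>
      have hnk : BddDiff k n := ih.1.add (ih.1.mul ih.1)
      have hθk : BddDiff k θ := (bddDiff_const k _).mul
        (((bddDiff_const k 2).mul hnk).sub ((hnk.comp_add_const 1).add (hnk.comp_add_const (-1))))
      exact ⟨BddDiff.succ_of_hasDerivAt hsb hsp ih.2, BddDiff.succ_of_hasDerivAt hpb hpθ hθk⟩
  refine ⟨s, fun k => (key k).1, hss, ?_⟩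
  have : (fun x => s (-x)) =ᵐ[volume] s := by
    filter_upwards [hss, ae_neg hss, show ∀ᵐ x : ℝ, ς (-x) = ς x from he] with x a b d
    rw [← a, ← b, d]
  exact congrFun (((hs.comp continuous_neg).ae_eq_iff_eq volume hs).1 this)

/-! ### Hyperbolic weights -/

/-- The hyperbolic tangent as a complex-valued function. -/
def th (x : ℝ) : ℂ := (Real.tanh x : ℝ)

/-- The weight `cosh^{-q}`. -/
def coshNeg (q x : ℝ) : ℂ := (Real.cosh x ^ (-q) : ℝ)

/-- The ratio of weights `cosh(x)^q / cosh(x + a)^q`. -/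
def coshRatio (q a x : ℝ) : ℂ := ((Real.cosh x / Real.cosh (x + a)) ^ q : ℝ)

/-- The zeroth order coefficient `cosh^q (cosh^{-q})''`. -/
def potential (q x : ℝ) : ℂ := (q : ℂ) ^ 2 * (th x * th x) - q * (1 - th x * th x)

theorem hasDerivAt_th (x : ℝ) : HasDerivAt th (1 - th x * th x) x := by
  have hc := (Real.cosh_pos x).ne'
  have h : HasDerivAt Real.tanh (1 - Real.tanh x * Real.tanh x) x := by
    have h1 := (Real.hasDerivAt_sinh x).div (Real.hasDerivAt_cosh x) hc
    have h2 : Real.tanh = Real.sinh / Real.cosh := by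
      ext y
      exact Real.tanh_eq_sinh_div_cosh y
    rw [h2]
    convert! h1 using 1
    simp only [Pi.div_apply]
    field_simp
  have := h.ofReal_comp
  convert! this using 1
  simp only [th]
  push_cast
  rfl

theorem norm_th_le (x : ℝ) : ‖th x‖ ≤ 1 := by
  rw [th, Complex.norm_real]
  exact (Real.abs_tanh_lt_one x).le

/-- The derivative `1 - th²` is a polynomial in `th`, so bounds propagate by induction. -/
theorem bddSmooth_th : BddSmooth th := by
  intro n
  induction n with
  | zero =>
    exact ⟨continuous_iff_continuousAt.2 fun x => (hasDerivAt_th x).continuousAt, 1, norm_th_le⟩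
  | succ n ih =>
    exact BddDiff.succ_of_hasDerivAt ⟨1, norm_th_le⟩ hasDerivAt_th
      ((bddDiff_const n 1).sub (ih.mul ih))

theorem th_neg (x : ℝ) : th (-x) = -th x := by simp [th]

theorem bddSmooth_potential (q : ℝ) : BddSmooth (potential q) := by
  have := bddSmooth_th.mul bddSmooth_th
  exact ((BddSmooth.const ((q : ℂ) ^ 2)).mul this).sub
    ((BddSmooth.const (q : ℂ)).mul ((BddSmooth.const 1).sub this))

theorem coshNeg_ne_zero (q x : ℝ) : coshNeg q x ≠ 0 := by
  rw [coshNeg, Complex.ofReal_ne_zero]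
  exact (Real.rpow_pos_of_pos (Real.cosh_pos x) _).ne'

theorem coshNeg_mul_coshPow (q x : ℝ) : coshNeg q x * ((Real.cosh x ^ q : ℝ) : ℂ) = 1 := by
  rw [coshNeg, ← Complex.ofReal_mul, ← Real.rpow_add (Real.cosh_pos x)]
  simp

theorem coshNeg_add (p q x : ℝ) : coshNeg p x * coshNeg q x = coshNeg (p + q) x := by
  rw [coshNeg, coshNeg, coshNeg, ← Complex.ofReal_mul, ← Real.rpow_add (Real.cosh_pos x)]
  congr 2; ring

theorem coshNeg_even (q x : ℝ) : coshNeg q (-x) = coshNeg q x := by simp [coshNeg]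

theorem hasDerivAt_coshNeg (q x : ℝ) :
    HasDerivAt (coshNeg q) (-q * th x * coshNeg q x) x := by
  have h := ((Real.hasDerivAt_cosh x).rpow_const (p := -q) (Or.inl (Real.cosh_pos x).ne')).ofReal_comp
  convert! h using 1
  rw [th, coshNeg, Real.tanh_eq_sinh_div_cosh, Real.rpow_sub_one (Real.cosh_pos x).ne']
  push_cast
  have : (Real.cosh x : ℂ) ≠ 0 := by exact_mod_cast (Real.cosh_pos x).ne'
  field_simp

theorem norm_coshNeg_le {q : ℝ} (hq : 0 ≤ q) (x : ℝ) : ‖coshNeg q x‖ ≤ 1 := by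
  rw [coshNeg, Complex.norm_real, Real.norm_of_nonneg (Real.rpow_nonneg (Real.cosh_pos x).le _)]
  exact Real.rpow_le_one_of_one_le_of_nonpos (Real.one_le_cosh x) (by linarith)

theorem bddSmooth_coshNeg {q : ℝ} (hq : 0 ≤ q) : BddSmooth (coshNeg q) := by
  intro n
  induction n with
  | zero =>
    exact ⟨continuous_iff_continuousAt.2 fun x => (hasDerivAt_coshNeg q x).continuousAt, 1,
      norm_coshNeg_le hq⟩
  | succ n ih =>
    exact BddDiff.succ_of_hasDerivAt ⟨1, norm_coshNeg_le hq⟩ (hasDerivAt_coshNeg q)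
      (((bddDiff_const n (-(q : ℂ))).mul (bddSmooth_th n)).mul ih)

theorem cosh_div_pos (a x : ℝ) : 0 < Real.cosh x / Real.cosh (x + a) :=
  div_pos (Real.cosh_pos _) (Real.cosh_pos _)

theorem cosh_div_le (a x : ℝ) : Real.cosh x / Real.cosh (x + a) ≤ Real.exp |a| := by
  rw [div_le_iff₀ (Real.cosh_pos _), Real.cosh_eq, Real.cosh_eq]
  have h1 : Real.exp x ≤ Real.exp |a| * Real.exp (x + a) := by
    rw [← Real.exp_add]
    exact Real.exp_le_exp.2 (by linarith [neg_abs_le a])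
  have h2 : Real.exp (-x) ≤ Real.exp |a| * Real.exp (-(x + a)) := by
    rw [← Real.exp_add]
    exact Real.exp_le_exp.2 (by linarith [le_abs_self a])
  linarith

theorem exp_le_cosh_div (a x : ℝ) : Real.exp (-|a|) ≤ Real.cosh x / Real.cosh (x + a) := by
  have h := cosh_div_le (-a) (x + a)
  rw [add_neg_cancel_right, abs_neg] at h
  rw [Real.exp_neg, ← inv_div]
  exact inv_anti₀ (div_pos (Real.cosh_pos _) (Real.cosh_pos _)) h

/-- The logarithmic derivative is a bounded smooth function, which makes the ratio itself bounded
smooth although `cosh^q` is unbounded for `q > 0`. -/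
theorem hasDerivAt_coshRatio (q a x : ℝ) :
    HasDerivAt (coshRatio q a) (q * (th x - th (x + a)) * coshRatio q a x) x := by
  have h0 := (Real.hasDerivAt_cosh x).div ((Real.hasDerivAt_cosh (x + a)).comp_add_const x a)
    (Real.cosh_pos _).ne'
  have h := (h0.rpow_const (p := q) (Or.inl (cosh_div_pos a x).ne')).ofReal_comp
  convert! h using 1
  simp only [Pi.div_apply]
  rw [th, th, coshRatio, Real.tanh_eq_sinh_div_cosh, Real.tanh_eq_sinh_div_cosh,
    Real.rpow_sub_one (cosh_div_pos a x).ne']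
  push_cast
  have h1 : Complex.cosh x ≠ 0 := by
    rw [← Complex.ofReal_cosh]; exact_mod_cast (Real.cosh_pos x).ne'
  have h2 : Complex.cosh (x + a) ≠ 0 := by
    rw [← Complex.ofReal_add, ← Complex.ofReal_cosh]; exact_mod_cast (Real.cosh_pos _).ne'
  field_simp

theorem norm_coshRatio_le {q : ℝ} (hq : 0 ≤ q) (a x : ℝ) :
    ‖coshRatio q a x‖ ≤ Real.exp (q * |a|) := by
  rw [coshRatio, Complex.norm_real, Real.norm_of_nonneg (Real.rpow_nonneg (cosh_div_pos a x).le _),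
    mul_comm, Real.exp_mul]
  exact Real.rpow_le_rpow (cosh_div_pos a x).le (cosh_div_le a x) hq

theorem norm_coshRatio_sub_one_le {q : ℝ} (hq : 0 ≤ q) (a x : ℝ) :
    ‖coshRatio q a x - 1‖ ≤ Real.exp (q * |a|) - 1 := by
  have h1 : (Real.cosh x / Real.cosh (x + a)) ^ q ≤ Real.exp (q * |a|) := by
    rw [mul_comm, Real.exp_mul]
    exact Real.rpow_le_rpow (cosh_div_pos a x).le (cosh_div_le a x) hq
  have h2 : Real.exp (-(q * |a|)) ≤ (Real.cosh x / Real.cosh (x + a)) ^ q := by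
    rw [← mul_neg, mul_comm, Real.exp_mul]
    exact Real.rpow_le_rpow (Real.exp_pos _).le (exp_le_cosh_div a x) hq
  rw [coshRatio, ← Complex.ofReal_one, ← Complex.ofReal_sub, Complex.norm_real, Real.norm_eq_abs,
    abs_le]
  refine ⟨?_, by linarith⟩
  -- This converts the lower deviation `1 - e^{-t}` into the upper one `e^t - 1`.
  have h3 : 2 ≤ Real.exp (q * |a|) + Real.exp (-(q * |a|)) := by
    have := Real.one_le_cosh (q * |a|)
    rw [Real.cosh_eq] at this
    linarith
  linarith

theorem coshRatio_add (p q a x : ℝ) :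
    coshRatio (p + q) a x = coshRatio p a x * coshRatio q a x := by
  rw [coshRatio, coshRatio, coshRatio, ← Complex.ofReal_mul, ← Real.rpow_add (cosh_div_pos a x)]

theorem bddSmooth_coshRatio {q : ℝ} (hq : 0 ≤ q) (a : ℝ) : BddSmooth (coshRatio q a) := by
  intro n
  induction n with
  | zero =>
    exact ⟨continuous_iff_continuousAt.2 fun x => (hasDerivAt_coshRatio q a x).continuousAt, _,
      norm_coshRatio_le hq a⟩
  | succ n ih =>
    exact BddDiff.succ_of_hasDerivAt ⟨_, norm_coshRatio_le hq a⟩ (hasDerivAt_coshRatio q a)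
      (((bddDiff_const n (q : ℂ)).mul ((bddSmooth_th n).sub
        ((bddSmooth_th n).comp_add_const a))).mul ih)

theorem coshRatio_neg (q a x : ℝ) : coshRatio q a (-x) = coshRatio q (-a) x := by
  rw [coshRatio, coshRatio, Real.cosh_neg, show -x + a = -(x + -a) by ring, Real.cosh_neg]

/-- The intertwining identity for the shifted terms: both sides equal `cosh(x)^q / cosh(x +
a)^{p+q}`. -/
theorem coshNeg_mul_coshRatio (p q a x : ℝ) :
    coshNeg p x * coshRatio (p + q) a x = coshRatio q a x * coshNeg p (x + a) := by
  rw [coshNeg, coshNeg, coshRatio, coshRatio, ← Complex.ofReal_mul, ← Complex.ofReal_mul,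
    Real.rpow_add (cosh_div_pos a x), Real.div_rpow (Real.cosh_pos _).le (Real.cosh_pos _).le p,
    Real.rpow_neg (Real.cosh_pos _).le, Real.rpow_neg (Real.cosh_pos _).le]
  congr 1
  have := (Real.rpow_pos_of_pos (Real.cosh_pos x) p).ne'
  field_simp

theorem integrable_cosh_rpow_neg {q : ℝ} (hq : 0 < q) :
    Integrable (fun x => Real.cosh x ^ (-q)) (volume : Measure ℝ) := by
  have hcont : Continuous fun x => Real.cosh x ^ (-q) :=
    Real.continuous_cosh.rpow_const fun x => Or.inl (Real.cosh_pos x).ne'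
  have h1 : IntegrableOn (fun x => Real.cosh x ^ (-q)) (Set.Ioi 0) := by
    have h2 : IntegrableOn (fun x => (2 : ℝ) ^ q * Real.exp (-q * x)) (Set.Ioi 0) :=
      (integrableOn_exp_mul_Ioi (by linarith) 0).const_mul _
    refine Integrable.mono' h2 hcont.aestronglyMeasurable (Eventually.of_forall fun x => ?_)
    rw [Real.norm_of_nonneg (Real.rpow_nonneg (Real.cosh_pos x).le _)]
    have h3 : Real.exp x / 2 ≤ Real.cosh x := by
      rw [Real.cosh_eq]
      linarith [Real.exp_pos (-x)]
    calc Real.cosh x ^ (-q) ≤ (Real.exp x / 2) ^ (-q) :=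
          Real.rpow_le_rpow_of_nonpos (by positivity) h3 (by linarith)
      _ = (2 : ℝ) ^ q * Real.exp (-q * x) := by
          rw [Real.div_rpow (Real.exp_pos x).le (by norm_num), ← Real.exp_mul,
            Real.rpow_neg (by norm_num : (0 : ℝ) ≤ 2), div_inv_eq_mul, mul_comm, mul_comm x]
  have h4 : IntegrableOn (fun x => Real.cosh x ^ (-q)) (Set.Iio 0) := by
    have h5 := IntegrableOn.comp_neg_Iio (c := (0 : ℝ)) (f := fun x => Real.cosh x ^ (-q))
      (by simpa using h1)
    simpa only [Real.cosh_neg] using h5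
  rw [← integrableOn_univ, ← Set.Iio_union_Ici (a := (0 : ℝ))]
  exact h4.union (integrableOn_Ici_iff_integrableOn_Ioi (by simp) |>.2 h1)

theorem memLp_coshNeg {q : ℝ} (hq : 0 < q) : MemLp (coshNeg q) 2 (volume : Measure ℝ) := by
  rw [memLp_two_iff_integrable_sq_norm (bddSmooth_coshNeg hq.le).continuous.aestronglyMeasurable]
  refine (integrable_cosh_rpow_neg (q := 2 * q) (by linarith)).congr
    (Eventually.of_forall fun x => ?_)
  change Real.cosh x ^ (-(2 * q)) = ‖coshNeg q x‖ ^ 2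
  rw [coshNeg, Complex.norm_real, Real.norm_of_nonneg (Real.rpow_nonneg (Real.cosh_pos x).le _),
    ← Real.rpow_natCast, ← Real.rpow_mul (Real.cosh_pos x).le]
  congr 1; push_cast; ring

section

/-! ### The conjugated operator -/

theorem D_add {f g : L2} (hf : f ∈ sobolev 1) (hg : g ∈ sobolev 1) : D (f + g) = D f + D g :=
  ((weakDeriv_D hf).add (weakDeriv_D hg)).D_eq

theorem D_smul (a : ℂ) {f : L2} (hf : f ∈ sobolev 1) : D (a • f) = a • D f :=
  ((weakDeriv_D hf).smul a).D_eq

/-- The nonlocal part `cosh^q (2 - A) (σ cosh^{-q} ·)` of the conjugated operator. -/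
def nonlocal (σ : ℝ → ℂ) (q : ℝ) (U : L2) : L2 :=
  (2 : ℂ) • mulL σ U - (mulL (coshRatio q 1) (shift 1 (mulL σ U)) +
    mulL (coshRatio q (-1)) (shift (-1) (mulL σ U)))

/-- The terms of order at most one of the conjugated operator. -/
def lowerOrder (c : ℝ) (σ : ℝ → ℂ) (q : ℝ) (U : L2) : L2 :=
  (c : ℂ) ^ 2 • (mulL (potential q) U - (2 * q : ℂ) • mulL th (D U)) + nonlocal σ q U

/-- The operator `cosh^q (c² ∂² + (2 - A) σ) cosh^{-q}`. -/
def conjOp (c : ℝ) (σ : ℝ → ℂ) (q : ℝ) (U : L2) : L2 :=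
  (c : ℂ) ^ 2 • D (D U) + lowerOrder c σ q U

variable {c : ℝ} {σ : ℝ → ℂ}

theorem nonlocal_ae (hσ : BddSmooth σ) {q : ℝ} (hq : 0 ≤ q) (U : L2) :
    nonlocal σ q U =ᵐ[volume] fun x => 2 * (σ x * U x) -
      (coshRatio q 1 x * (σ (x + 1) * U (x + 1)) +
        coshRatio q (-1) x * (σ (x + -1) * U (x + -1))) := by
  have h0 := mulL_ae hσ U
  have hs : ∀ a, shift a (mulL σ U) =ᵐ[volume] fun x => σ (x + a) * U (x + a) := fun a => by
    filter_upwards [shift_ae a (mulL σ U), ae_add_const a h0] with x h1 h2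
    rw [h1, h2]
  have hk : ∀ a, mulL (coshRatio q a) (shift a (mulL σ U)) =ᵐ[volume]
      fun x => coshRatio q a x * (σ (x + a) * U (x + a)) := fun a => by
    filter_upwards [mulL_ae (bddSmooth_coshRatio hq a) (shift a (mulL σ U)), hs a] with x h1 h2
    rw [h1, h2]
  unfold nonlocal
  filter_upwards [h0, hk 1, hk (-1), Lp.coeFn_sub ((2 : ℂ) • mulL σ U)
      (mulL (coshRatio q 1) (shift 1 (mulL σ U)) +
        mulL (coshRatio q (-1)) (shift (-1) (mulL σ U))), Lp.coeFn_smul (2 : ℂ) (mulL σ U),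
      Lp.coeFn_add (mulL (coshRatio q 1) (shift 1 (mulL σ U)))
        (mulL (coshRatio q (-1)) (shift (-1) (mulL σ U)))] with x h1 h2 h3 h4 h5 h6
  rw [h4, Pi.sub_apply, h5, h6, Pi.add_apply, Pi.smul_apply, h1, h2, h3, smul_eq_mul]

theorem lowerOrder_ae (hσ : BddSmooth σ) {q : ℝ} (hq : 0 ≤ q) (U : L2) :
    lowerOrder c σ q U =ᵐ[volume] fun x =>
      (c : ℂ) ^ 2 * (potential q x * U x - 2 * q * (th x * D U x)) +
      (2 * (σ x * U x) - (coshRatio q 1 x * (σ (x + 1) * U (x + 1)) +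
        coshRatio q (-1) x * (σ (x + -1) * U (x + -1)))) := by
  unfold lowerOrder
  filter_upwards [nonlocal_ae hσ hq U, mulL_ae (bddSmooth_potential q) U,
    mulL_ae bddSmooth_th (D U),
    Lp.coeFn_add ((c : ℂ) ^ 2 • (mulL (potential q) U - (2 * q : ℂ) • mulL th (D U)))
      (nonlocal σ q U),
    Lp.coeFn_smul ((c : ℂ) ^ 2) (mulL (potential q) U - (2 * q : ℂ) • mulL th (D U)),
    Lp.coeFn_sub (mulL (potential q) U) ((2 * q : ℂ) • mulL th (D U)),
    Lp.coeFn_smul (2 * q : ℂ) (mulL th (D U))] with x h1 h2 h3 h4 h5 h6 h7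
  rw [h4, Pi.add_apply, h5, Pi.smul_apply, h6, Pi.sub_apply, h7, Pi.smul_apply, h1, h2, h3,
    smul_eq_mul, smul_eq_mul]

theorem conjOp_ae (hσ : BddSmooth σ) {q : ℝ} (hq : 0 ≤ q) (U : L2) :
    conjOp c σ q U =ᵐ[volume] fun x =>
      (c : ℂ) ^ 2 * (D (D U) x + potential q x * U x - 2 * q * (th x * D U x)) +
      (2 * (σ x * U x) - (coshRatio q 1 x * (σ (x + 1) * U (x + 1)) +
        coshRatio q (-1) x * (σ (x + -1) * U (x + -1)))) := by
  unfold conjOp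
  filter_upwards [lowerOrder_ae (c := c) hσ hq U,
    Lp.coeFn_add ((c : ℂ) ^ 2 • D (D U)) (lowerOrder c σ q U),
    Lp.coeFn_smul ((c : ℂ) ^ 2) (D (D U))] with x h1 h2 h3
  rw [h2, Pi.add_apply, h3, Pi.smul_apply, h1, smul_eq_mul]
  ring

theorem nonlocal_add (hσ : BddSmooth σ) {q : ℝ} (hq : 0 ≤ q) (U V : L2) :
    nonlocal σ q (U + V) = nonlocal σ q U + nonlocal σ q V := by
  unfold nonlocal
  rw [mulL_add hσ, map_add, map_add, mulL_add (bddSmooth_coshRatio hq 1),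
    mulL_add (bddSmooth_coshRatio hq (-1)), smul_add]
  abel

theorem nonlocal_smul (hσ : BddSmooth σ) {q : ℝ} (hq : 0 ≤ q) (a : ℂ) (U : L2) :
    nonlocal σ q (a • U) = a • nonlocal σ q U := by
  unfold nonlocal
  rw [mulL_smul hσ, map_smul, map_smul, mulL_smul (bddSmooth_coshRatio hq 1),
    mulL_smul (bddSmooth_coshRatio hq (-1)), smul_sub, smul_add, smul_comm a]

theorem conjOp_add (hσ : BddSmooth σ) {q : ℝ} (hq : 0 ≤ q) {U V : L2} (hU : U ∈ sobolev 2)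
    (hV : V ∈ sobolev 2) : conjOp c σ q (U + V) = conjOp c σ q U + conjOp c σ q V := by
  have h12 : (1 : ℝ) ≤ 2 := by norm_num
  unfold conjOp lowerOrder
  rw [D_add (sobolev_mono h12 hU) (sobolev_mono h12 hV),
    D_add (D_mem_sobolev_one hU) (D_mem_sobolev_one hV), nonlocal_add hσ hq,
    mulL_add (bddSmooth_potential q), mulL_add bddSmooth_th]
  module

theorem conjOp_smul (hσ : BddSmooth σ) {q : ℝ} (hq : 0 ≤ q) (a : ℂ) {U : L2}
    (hU : U ∈ sobolev 2) : conjOp c σ q (a • U) = a • conjOp c σ q U := by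
  have h12 : (1 : ℝ) ≤ 2 := by norm_num
  unfold conjOp lowerOrder
  rw [D_smul a (sobolev_mono h12 hU), D_smul a (D_mem_sobolev_one hU), nonlocal_smul hσ hq,
    mulL_smul (bddSmooth_potential q), mulL_smul bddSmooth_th]
  module

theorem conjOp_sub (hσ : BddSmooth σ) {q : ℝ} (hq : 0 ≤ q) {U V : L2} (hU : U ∈ sobolev 2)
    (hV : V ∈ sobolev 2) : conjOp c σ q (U - V) = conjOp c σ q U - conjOp c σ q V := by
  have := conjOp_add (c := c) hσ hq hU ((sobolev 2).smul_mem (-1 : ℂ) hV)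
  rw [conjOp_smul hσ hq _ hV] at this
  simpa [sub_eq_add_neg] using this

theorem D_mulL {m m' : ℝ → ℂ} (hm : BddSmooth m) (hd : ∀ x, HasDerivAt m (m' x) x) {f : L2}
    (hf : f ∈ sobolev 1) : D (mulL m f) = mulL m (D f) + mulL m' f := by
  rw [((weakDeriv_D hf).mulL hm).D_eq, show deriv m = m' from funext fun x => (hd x).deriv]

theorem mulL_mem_sobolev_two {m : ℝ → ℂ} (hm : BddSmooth m) {f : L2} (hf : f ∈ sobolev 2) :
    mulL m f ∈ sobolev 2 := by
  obtain ⟨C, hC⟩ := mulL_sobolev hm 2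
  exact_mod_cast (hC f (by exact_mod_cast hf)).1

/-- Conjugation by `cosh^δ` shifts the weight. -/
theorem mulL_coshNeg_conjOp (hσ : BddSmooth σ) {p δ : ℝ} (hp : 0 ≤ p) (hδ : 0 ≤ δ) {U : L2}
    (hU : U ∈ sobolev 2) :
    mulL (coshNeg δ) (conjOp c σ (δ + p) U) = conjOp c σ p (mulL (coshNeg δ) U) := by
  have h12 : (1 : ℝ) ≤ 2 := by norm_num
  have hm := bddSmooth_coshNeg hδ
  have hU1 := sobolev_mono h12 hU
  set m' : ℝ → ℂ := fun x => -δ * th x * coshNeg δ x with hm'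
  have hm's : BddSmooth m' := ((BddSmooth.const (-(δ : ℂ))).mul bddSmooth_th).mul hm
  have hd1 : D (mulL (coshNeg δ) U) = mulL (coshNeg δ) (D U) + mulL m' U :=
    D_mulL hm (hasDerivAt_coshNeg δ) hU1
  set m'' : ℝ → ℂ := fun x => (-δ * (1 - th x * th x)) * coshNeg δ x +
    (-δ * th x) * (-δ * th x * coshNeg δ x) with hm''
  have hdm' : ∀ x, HasDerivAt m' (m'' x) x := fun x =>
    ((hasDerivAt_th x).const_mul (-(δ : ℂ))).mul (hasDerivAt_coshNeg δ x)
  have hm''s : BddSmooth m'' := by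
    have := hm's.deriv
    rwa [show deriv m' = m'' from funext fun x => (hdm' x).deriv] at this
  have s1 : mulL (coshNeg δ) (D U) ∈ sobolev 1 :=
    ((weakDeriv_D (D_mem_sobolev_one hU)).mulL hm).mem_sobolev_one
  have s2 : mulL m' U ∈ sobolev 1 := ((weakDeriv_D hU1).mulL hm's).mem_sobolev_one
  have hd2 : D (D (mulL (coshNeg δ) U)) = mulL (coshNeg δ) (D (D U)) + mulL m' (D U) +
      (mulL m' (D U) + mulL m'' U) := by
    rw [hd1, D_add s1 s2, D_mulL hm (hasDerivAt_coshNeg δ) (D_mem_sobolev_one hU),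
      D_mulL hm's hdm' hU1]
  have a1 : D (mulL (coshNeg δ) U) =ᵐ[volume]
      fun x => coshNeg δ x * D U x + m' x * U x := by
    rw [hd1]
    filter_upwards [Lp.coeFn_add (mulL (coshNeg δ) (D U)) (mulL m' U), mulL_ae hm (D U),
      mulL_ae hm's U] with x h1 h2 h3
    rw [h1, Pi.add_apply, h2, h3]
  have a2 : D (D (mulL (coshNeg δ) U)) =ᵐ[volume]
      fun x => coshNeg δ x * D (D U) x + m' x * D U x + (m' x * D U x + m'' x * U x) := by
    rw [hd2]
    filter_upwards [Lp.coeFn_add (mulL (coshNeg δ) (D (D U)) + mulL m' (D U))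
      (mulL m' (D U) + mulL m'' U), Lp.coeFn_add (mulL (coshNeg δ) (D (D U))) (mulL m' (D U)),
      Lp.coeFn_add (mulL m' (D U)) (mulL m'' U), mulL_ae hm (D (D U)), mulL_ae hm's (D U),
      mulL_ae hm''s U] with x h1 h2 h3 h4 h5 h6
    rw [h1, Pi.add_apply, h2, h3, Pi.add_apply, Pi.add_apply, h4, h5, h6]
  have a0 := mulL_ae hm U
  ext1
  filter_upwards [mulL_ae hm (conjOp c σ (δ + p) U), conjOp_ae (c := c) hσ (add_nonneg hδ hp) U,
    conjOp_ae (c := c) hσ hp (mulL (coshNeg δ) U), a0, ae_add_const 1 a0, ae_add_const (-1) a0,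
    a1, a2] with x h1 h2 h3 h4 h5 h6 h7 h8
  rw [h1, h2, h3, h4, h5, h6, h7, h8]
  -- The two shifted terms are the only ones needing an identity for the weights. The local terms
  -- match as polynomials in `th`.
  have k1 := coshNeg_mul_coshRatio δ p 1 x
  have k2 := coshNeg_mul_coshRatio δ p (-1) x
  simp only [hm', hm'', potential]
  push_cast
  linear_combination (-(σ (x + 1) * U (x + 1))) * k1 - (σ (x + -1) * U (x + -1)) * k2

end

section

/-! ### Mapping properties of the conjugated operator -/

/-- `T` maps `H^s` boundedly into `H^t`. -/
def SobolevBdd (s t : ℝ) (T : L2 → L2) : Prop :=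
  ∃ C : ℝ≥0, ∀ U ∈ sobolev s, T U ∈ sobolev t ∧ sobolevENorm t (T U) ≤ C * sobolevENorm s U

namespace SobolevBdd

variable {s t u : ℝ} {T S : L2 → L2}

theorem add (hT : SobolevBdd s t T) (hS : SobolevBdd s t S) :
    SobolevBdd s t fun U => T U + S U := by
  obtain ⟨C, hC⟩ := hT
  obtain ⟨C', hC'⟩ := hS
  refine ⟨C + C', fun U hU => ⟨add_mem (hC U hU).1 (hC' U hU).1, ?_⟩⟩
  refine (sobolevENorm_add _ _ _).trans ?_
  rw [ENNReal.coe_add, add_mul]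
  exact add_le_add (hC U hU).2 (hC' U hU).2

theorem smul (a : ℂ) (hT : SobolevBdd s t T) : SobolevBdd s t fun U => a • T U := by
  obtain ⟨C, hC⟩ := hT
  refine ⟨‖a‖₊ * C, fun U hU => ⟨Submodule.smul_mem _ _ (hC U hU).1, ?_⟩⟩
  rw [sobolevENorm_smul, ENNReal.coe_mul, mul_assoc]
  exact mul_le_mul_right (hC U hU).2 _

theorem sub (hT : SobolevBdd s t T) (hS : SobolevBdd s t S) :
    SobolevBdd s t fun U => T U - S U := by
  have := hT.add (hS.smul (-1))
  simpa [sub_eq_add_neg] using this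

theorem comp (hS : SobolevBdd t u S) (hT : SobolevBdd s t T) :
    SobolevBdd s u fun U => S (T U) := by
  obtain ⟨C, hC⟩ := hT
  obtain ⟨C', hC'⟩ := hS
  refine ⟨C' * C, fun U hU => ⟨(hC' _ (hC U hU).1).1, ?_⟩⟩
  refine (hC' _ (hC U hU).1).2.trans ?_
  rw [ENNReal.coe_mul, mul_assoc]
  exact mul_le_mul_right (hC U hU).2 _

theorem of_le (h : t ≤ s) : SobolevBdd s t fun U => U :=
  ⟨1, fun U hU => ⟨sobolev_mono h hU, by simpa using sobolevENorm_mono h U⟩⟩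

theorem deriv (hs : 0 ≤ s) : SobolevBdd (s + 1) s D :=
  ⟨1, fun U hU => ⟨D_mem_sobolev hs hU, by
    simpa using sobolevENorm_D_le s (sobolev_mono (by linarith) hU)⟩⟩

end SobolevBdd

variable {c : ℝ} {σ : ℝ → ℂ}

theorem sobolevBdd_nonlocal (hσ : BddSmooth σ) {q : ℝ} (hq : 0 ≤ q) (n : ℕ) :
    SobolevBdd n n (nonlocal σ q) := by
  have h0 : SobolevBdd n n (mulL σ) := mulL_sobolev hσ n
  have h1 : ∀ a, SobolevBdd n n fun U => mulL (coshRatio q a) (shift a (mulL σ U)) := fun a =>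
    SobolevBdd.comp (mulL_sobolev (bddSmooth_coshRatio hq a) n)
      (SobolevBdd.comp (shift_sobolev a n) h0)
  exact (h0.smul 2).sub ((h1 1).add (h1 (-1)))

/-- Only one derivative of `U` is lost. The spare derivative drives the elliptic bootstrap and
leaves room for non-integer orders. -/
theorem sobolevBdd_lowerOrder (hσ : BddSmooth σ) {q : ℝ} (hq : 0 ≤ q) (n : ℕ) :
    SobolevBdd (n + 2) (n + 1) (lowerOrder c σ q) := by
  have hn : (0 : ℝ) ≤ n := n.cast_nonneg
  have e : ((n : ℝ) + 1) = ((n + 1 : ℕ) : ℝ) := by push_cast; rfl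
  have hid : SobolevBdd ((n : ℝ) + 2) (n + 1) fun U => U := SobolevBdd.of_le (by linarith)
  have hD : SobolevBdd ((n : ℝ) + 2) (n + 1) D := by
    have := SobolevBdd.deriv (s := (n : ℝ) + 1) (by linarith)
    rwa [show (n : ℝ) + 1 + 1 = n + 2 by ring] at this
  have hm : ∀ {m : ℝ → ℂ}, BddSmooth m → SobolevBdd ((n : ℝ) + 1) (n + 1) (mulL m) := fun h => by
    rw [e]
    exact mulL_sobolev h (n + 1)
  have hnl : SobolevBdd ((n : ℝ) + 1) (n + 1) (nonlocal σ q) := by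
    rw [e]
    exact sobolevBdd_nonlocal hσ hq (n + 1)
  exact ((((hm (bddSmooth_potential q)).comp hid).sub
    (((hm bddSmooth_th).comp hD).smul (2 * q : ℂ))).smul ((c : ℂ) ^ 2)).add (hnl.comp hid)

theorem exists_nat_between {r : ℝ} (hr : 0 ≤ r) : ∃ n : ℕ, (n : ℝ) ≤ r ∧ r ≤ n + 1 :=
  ⟨⌊r⌋₊, Nat.floor_le hr, (Nat.lt_floor_add_one r).le⟩

/-- The term `∂²` acts exactly on the real scale. The variable-coefficient terms are estimated at
integer order, as `H^{r+2} ⊂ H^{n+2} → H^{n+1} ⊂ H^r` for `n ≤ r ≤ n + 1`. -/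
theorem sobolevBdd_conjOp (hσ : BddSmooth σ) {q : ℝ} (hq : 0 ≤ q) {r : ℝ} (hr : 0 ≤ r) :
    SobolevBdd (r + 2) r (conjOp c σ q) := by
  obtain ⟨n, hn, hn'⟩ := exists_nat_between hr
  have h1 : SobolevBdd (r + 2) r (lowerOrder c σ q) :=
    (SobolevBdd.of_le hn').comp ((sobolevBdd_lowerOrder hσ hq n).comp
      (SobolevBdd.of_le (by linarith)))
  have h2 : SobolevBdd (r + 2) r fun U => D (D U) := by
    refine (SobolevBdd.deriv hr).comp ?_
    have := SobolevBdd.deriv (s := r + 1) (by linarith)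
    rwa [show r + 1 + 1 = r + 2 by ring] at this
  exact (h2.smul ((c : ℂ) ^ 2)).add h1

/-- Elliptic regularity, gaining at most one derivative over the order `n + 2` already known. -/
theorem conjOp_regularity_step (hc : c ≠ 0) (hσ : BddSmooth σ) {q : ℝ} (hq : 0 ≤ q) (n : ℕ) {r : ℝ}
    (hn : n ≤ r) (hn' : r ≤ n + 1) :
    ∃ C : ℝ≥0, ∀ U ∈ sobolev ((n : ℝ) + 2), conjOp c σ q U ∈ sobolev r →
      U ∈ sobolev (r + 2) ∧ sobolevENorm (r + 2) U ≤
        C * (sobolevENorm (n + 2) U + sobolevENorm r (conjOp c σ q U)) := by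
  have hn0 : (0 : ℝ) ≤ n := n.cast_nonneg
  have hr : 0 ≤ r := hn0.trans hn
  obtain ⟨B, hB⟩ := sobolevBdd_lowerOrder (c := c) hσ hq n
  have hcC : (c : ℂ) ^ 2 ≠ 0 := pow_ne_zero _ (by exact_mod_cast hc)
  set a : ℂ := ((c : ℂ) ^ 2)⁻¹ with ha
  refine ⟨2 + ‖a‖₊ * (B + 1), fun U hU hG => ?_⟩
  set G := conjOp c σ q U with hGdef
  have hU1 : U ∈ sobolev 1 := sobolev_mono (by linarith) hU
  have hU2 : U ∈ sobolev 2 := sobolev_mono (by linarith) hU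
  -- Ellipticity: the equation is solved for the top derivative, which then lies in `H^r` since the
  -- lower-order terms are in `H^{n+1}`.
  have hDD : D (D U) = a • (G - lowerOrder c σ q U) := by
    rw [hGdef, conjOp, add_sub_cancel_right, smul_smul, ha, inv_mul_cancel₀ hcC, one_smul]
  obtain ⟨hL1, hL2⟩ := hB U hU
  have hDDr : sobolevENorm r (D (D U)) ≤
      ‖a‖₊ * (sobolevENorm r G + B * sobolevENorm (n + 2) U) := by
    rw [hDD, sobolevENorm_smul]
    refine mul_le_mul_right ((sobolevENorm_sub _ _ _).trans ?_) _
    gcongr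
    exact (sobolevENorm_mono hn' _).trans hL2
  have hDDm : D (D U) ∈ sobolev r := by
    rw [hDD]
    exact Submodule.smul_mem _ _ (sub_mem hG (sobolev_mono hn' hL1))
  have w1 : WeakDeriv U (D U) := weakDeriv_D hU1
  have w2 : WeakDeriv (D U) (D (D U)) := weakDeriv_D (D_mem_sobolev_one hU2)
  have hDUn : sobolevENorm (n + 1) (D U) ≤ sobolevENorm (n + 2) U := by
    have := w1.sobolevENorm_le (n + 1)
    rwa [show (n : ℝ) + 1 + 1 = n + 2 by ring] at this
  have hbound : sobolevENorm (r + 2) U ≤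
      2 * sobolevENorm (n + 2) U + sobolevENorm r (D (D U)) := by
    calc sobolevENorm (r + 2) U = sobolevENorm (r + 1 + 1) U := by ring_nf
      _ ≤ sobolevENorm (r + 1) U + sobolevENorm (r + 1) (D U) := w1.sobolevENorm_succ_le _
      _ ≤ sobolevENorm (n + 2) U + (sobolevENorm r (D U) + sobolevENorm r (D (D U))) :=
          add_le_add (sobolevENorm_mono (by linarith) _) (w2.sobolevENorm_succ_le _)
      _ ≤ sobolevENorm (n + 2) U + (sobolevENorm (n + 2) U + sobolevENorm r (D (D U))) := by
          gcongr
          exact (sobolevENorm_mono hn' _).trans hDUn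
      _ = _ := by ring
  constructor
  · rw [mem_sobolev_iff (by linarith)]
    refine hbound.trans_lt (ENNReal.add_lt_top.2 ⟨ENNReal.mul_lt_top (by simp) ?_, ?_⟩)
    · exact (mem_sobolev_iff (by linarith) _).1 hU
    · exact (mem_sobolev_iff hr _).1 hDDm
  · refine hbound.trans ((add_le_add le_rfl hDDr).trans ?_)
    push_cast
    set X := sobolevENorm (n + 2) U
    set Y := sobolevENorm r G
    calc 2 * X + ‖a‖₊ * (Y + B * X) ≤ 2 * X + ‖a‖₊ * (Y + B * X) + (2 * Y + ‖a‖₊ * (B * Y + X)) :=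
          le_self_add
      _ = (2 + ‖a‖₊ * (B + 1)) * (X + Y) := by ring

/-- The one-step gain is iterated through the integers up to some `n ≤ r ≤ n + 1`; a last, possibly
fractional, step reaches `r`. -/
theorem conjOp_regularity (hc : c ≠ 0) (hσ : BddSmooth σ) {q : ℝ} (hq : 0 ≤ q) {r : ℝ}
    (hr : 0 ≤ r) :
    ∃ C : ℝ≥0, ∀ U ∈ sobolev 2, conjOp c σ q U ∈ sobolev r →
      U ∈ sobolev (r + 2) ∧ sobolevENorm (r + 2) U ≤
        C * (sobolevENorm 2 U + sobolevENorm r (conjOp c σ q U)) := by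
  have hnat : ∀ n : ℕ, ∃ C : ℝ≥0, ∀ U ∈ sobolev 2, conjOp c σ q U ∈ sobolev (n : ℝ) →
      U ∈ sobolev ((n : ℝ) + 2) ∧ sobolevENorm ((n : ℝ) + 2) U ≤
        C * (sobolevENorm 2 U + sobolevENorm n (conjOp c σ q U)) := by
    intro n
    induction n with
    | zero =>
      refine ⟨1, fun U hU _ => ?_⟩
      simp only [Nat.cast_zero, zero_add, ENNReal.coe_one, one_mul]
      exact ⟨hU, le_self_add⟩
    | succ n ih =>
      obtain ⟨C, hC⟩ := ih
      obtain ⟨C', hC'⟩ := conjOp_regularity_step hc hσ hq n (r := n + 1) (by linarith) le_rfl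
      refine ⟨C' * (C + 1), fun U hU hG => ?_⟩
      push_cast at hG ⊢
      obtain ⟨h1, h2⟩ := hC U hU (sobolev_mono (by linarith) hG)
      obtain ⟨h3, h4⟩ := hC' U h1 hG
      refine ⟨h3, h4.trans ?_⟩
      rw [mul_assoc]
      gcongr
      calc sobolevENorm (n + 2) U + sobolevENorm (n + 1) (conjOp c σ q U)
          ≤ C * (sobolevENorm 2 U + sobolevENorm (n + 1) (conjOp c σ q U)) +
            (sobolevENorm 2 U + sobolevENorm (n + 1) (conjOp c σ q U)) := by
            refine add_le_add (h2.trans ?_) le_add_self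
            gcongr
            exact sobolevENorm_mono (by linarith) _
        _ = _ := by ring
  obtain ⟨n, hn, hn'⟩ := exists_nat_between hr
  obtain ⟨C, hC⟩ := hnat n
  obtain ⟨C', hC'⟩ := conjOp_regularity_step hc hσ hq n hn hn'
  refine ⟨C' * (C + 1), fun U hU hG => ?_⟩
  obtain ⟨h1, h2⟩ := hC U hU (sobolev_mono hn hG)
  obtain ⟨h3, h4⟩ := hC' U h1 hG
  refine ⟨h3, h4.trans ?_⟩
  push_cast
  rw [mul_assoc]
  gcongr
  calc sobolevENorm (n + 2) U + sobolevENorm r (conjOp c σ q U)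
      ≤ C * (sobolevENorm 2 U + sobolevENorm r (conjOp c σ q U)) +
        (sobolevENorm 2 U + sobolevENorm r (conjOp c σ q U)) := by
        refine add_le_add (h2.trans ?_) le_add_self
        gcongr
        exact sobolevENorm_mono hn _
    _ = _ := by ring

/-! ### Parity -/

theorem refl_D {U : L2} (hU : U ∈ sobolev 1) (he : refl U = U) : refl (D U) = -D U := by
  have h1 := (weakDeriv_D hU).refl
  rw [he] at h1
  exact neg_eq_iff_eq_neg.1 ((weakDeriv_D hU).unique h1).symm

/-- The first-order term is a product of the odd functions `th` and `U'`, and reflection exchanges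
the two shifted terms. -/
theorem conjOp_even (hσ : BddSmooth σ) (hσe : ∀ x, σ (-x) = σ x) {q : ℝ} (hq : 0 ≤ q) {U : L2}
    (hU : U ∈ sobolev 2) (he : U ∈ evenL2) : conjOp c σ q U ∈ evenL2 := by
  rw [mem_evenL2_iff] at he
  have w1 : WeakDeriv U (D U) := weakDeriv_D (sobolev_mono (by norm_num) hU)
  have w2 : WeakDeriv (D U) (D (D U)) := weakDeriv_D (D_mem_sobolev_one hU)
  have e1 : refl (D U) = -D U := refl_D (sobolev_mono (by norm_num) hU) he
  have e2 : refl (D (D U)) = D (D U) := by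
    have h1 := w2.refl
    rw [e1] at h1
    have h2 := w2.smul (-1)
    simp only [neg_smul, one_smul] at h2
    simpa using h1.unique h2
  have b0 : ∀ᵐ x : ℝ, U (-x) = U x := (mem_evenL2_iff U).2 he
  have b1 : ∀ᵐ x : ℝ, D U (-x) = -D U x := by
    filter_upwards [refl_ae (D U), Lp.coeFn_neg (D U), (Lp.ext_iff.1 e1)] with x h1 h2 h3
    rw [← h1, h3, h2, Pi.neg_apply]
  have b2 : ∀ᵐ x : ℝ, D (D U) (-x) = D (D U) x := (mem_evenL2_iff _).2 e2
  change ∀ᵐ x : ℝ, conjOp c σ q U (-x) = conjOp c σ q U x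
  have hae := conjOp_ae (c := c) hσ hq U
  filter_upwards [hae, ae_neg hae, b0, b1, b2, ae_add_const 1 b0, ae_add_const (-1) b0]
    with x h1 h2 h3 h4 h5 h6 h7
  rw [h1, h2, h3, h4, h5, show -x + 1 = -(x + -1) by ring, show -x + -1 = -(x + 1) by ring, h6, h7,
    hσe, hσe, hσe, coshRatio_neg, coshRatio_neg, neg_neg]
  simp only [potential, th_neg]
  ring

/-! ### Continuity in the weight -/

theorem norm_potential_sub_le {p q : ℝ} (hp : 0 ≤ p) (hpq : p ≤ q) (x : ℝ) :
    ‖potential q x - potential p x‖ ≤ (q ^ 2 - p ^ 2) + (q - p) := by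
  have e : potential q x - potential p x =
      ((((q ^ 2 - p ^ 2) * (Real.tanh x * Real.tanh x) -
        (q - p) * (1 - Real.tanh x * Real.tanh x) : ℝ)) : ℂ) := by
    simp only [potential, th]
    push_cast
    ring
  have h1 : Real.tanh x * Real.tanh x ≤ 1 := by nlinarith [Real.tanh_sq_lt_one x]
  have h0 : 0 ≤ Real.tanh x * Real.tanh x := mul_self_nonneg _
  have h2 : 0 ≤ q ^ 2 - p ^ 2 := by nlinarith
  rw [e, Complex.norm_real, Real.norm_eq_abs, abs_le]
  constructor <;> nlinarith

theorem norm_coshRatio_diff_le {p q : ℝ} (hp : 0 ≤ p) (hpq : p ≤ q) (a x : ℝ) :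
    ‖coshRatio q a x - coshRatio p a x‖ ≤
      Real.exp (p * |a|) * (Real.exp ((q - p) * |a|) - 1) := by
  have e : coshRatio q a x - coshRatio p a x =
      coshRatio p a x * (coshRatio (q - p) a x - 1) := by
    rw [mul_sub, ← coshRatio_add, mul_one]
    congr 2; ring
  rw [e, norm_mul]
  gcongr
  · exact norm_coshRatio_le hp a x
  · exact norm_coshRatio_sub_one_le (by linarith) a x

theorem mulL_sub_left {m k : ℝ → ℂ} (hm : BddSmooth m) (hk : BddSmooth k) (f : L2) :
    mulL (fun x => m x - k x) f = mulL m f - mulL k f := by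
  ext1
  filter_upwards [mulL_ae hm f, mulL_ae hk f, mulL_ae (hm.sub hk) f,
    Lp.coeFn_sub (mulL m f) (mulL k f)] with x a b d e
  rw [d, e, Pi.sub_apply, a, b, sub_mul]

theorem norm_le_of_sobolevENorm_le {f : L2} {r : ℝ} (hr : 0 ≤ r) {U : L2} (hU : U ∈ sobolev r)
    (h : ‖f‖ₑ ≤ sobolevENorm r U) : ‖f‖ ≤ (sobolevENorm r U).toReal := by
  have h1 : sobolevENorm r U ≠ ∞ := ((mem_sobolev_iff hr U).1 hU).ne
  rw [← toReal_enorm]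
  exact ENNReal.toReal_mono h1 h

/-- The second-order terms cancel in the difference. What remains has coefficients that tend to zero
uniformly in `x` as `q` decreases to `p`. -/
theorem exists_conjOp_sub_le (hσ : BddSmooth σ) {p : ℝ} (hp : 0 ≤ p) {ε : ℝ} (hε : 0 < ε) :
    ∃ δ > 0, ∀ q, p ≤ q → q ≤ p + δ → ∀ U ∈ sobolev 2,
      ‖conjOp c σ q U - conjOp c σ p U‖ ≤ ε * (sobolevENorm 2 U).toReal := by
  obtain ⟨M, hM⟩ := hσ.bdd
  have hM0 : 0 ≤ M := (norm_nonneg _).trans (hM 0)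
  -- This sums the bounds for the potential, for the coefficient `2(q - p)` of the first-order term,
  -- and for the two shifts by `±1`.
  let η : ℝ → ℝ := fun q => c ^ 2 * (((q ^ 2 - p ^ 2) + (q - p)) + 2 * (q - p)) +
    2 * (Real.exp p * (Real.exp (q - p) - 1) * M)
  have hη : Continuous η := by fun_prop
  have hηp : η p = 0 := by simp [η]
  have hlt : ∀ᶠ q in nhds p, η q < ε := hη.continuousAt.eventually_lt continuousAt_const (by
    rw [hηp]; exact hε)
  obtain ⟨δ, hδ, hball⟩ := Metric.eventually_nhds_iff.1 hlt
  refine ⟨δ / 2, by positivity, fun q hpq hqδ U hU => ?_⟩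
  have hηq : η q < ε := hball (by rw [Real.dist_eq, abs_of_nonneg (by linarith)]; linarith)
  have hq : 0 ≤ q := hp.trans hpq
  set N := (sobolevENorm 2 U).toReal with hN
  have hN0 : 0 ≤ N := ENNReal.toReal_nonneg
  have hU0 : ‖U‖ ≤ N :=
    norm_le_of_sobolevENorm_le (by norm_num) hU (enorm_le_sobolevENorm (by norm_num) U)
  have hU1 : ‖D U‖ ≤ N := by
    refine norm_le_of_sobolevENorm_le (by norm_num) hU ?_
    refine (enorm_le_sobolevENorm (r := 0) le_rfl _).trans ?_
    exact (sobolevENorm_D_le 0 (sobolev_mono (by norm_num) hU)).trans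
      (sobolevENorm_mono (by norm_num) U)
  have hdec : conjOp c σ q U - conjOp c σ p U =
      (c : ℂ) ^ 2 • (mulL (fun x => potential q x - potential p x) U -
        (2 * (q - p) : ℂ) • mulL th (D U)) -
      (mulL (fun x => coshRatio q 1 x - coshRatio p 1 x) (shift 1 (mulL σ U)) +
        mulL (fun x => coshRatio q (-1) x - coshRatio p (-1) x) (shift (-1) (mulL σ U))) := by
    rw [mulL_sub_left (bddSmooth_potential q) (bddSmooth_potential p),
      mulL_sub_left (bddSmooth_coshRatio hq _) (bddSmooth_coshRatio hp _),
      mulL_sub_left (bddSmooth_coshRatio hq _) (bddSmooth_coshRatio hp _)]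
    unfold conjOp lowerOrder nonlocal
    module
  have t1 : ‖mulL (fun x => potential q x - potential p x) U‖ ≤
      ((q ^ 2 - p ^ 2) + (q - p)) * N := by
    refine (norm_mulL_le ((bddSmooth_potential q).sub (bddSmooth_potential p))
      (norm_potential_sub_le hp hpq) U).trans ?_
    have : 0 ≤ (q ^ 2 - p ^ 2) + (q - p) := by nlinarith
    gcongr
  have t2 : ‖(2 * (q - p) : ℂ) • mulL th (D U)‖ ≤ 2 * (q - p) * N := by
    rw [norm_smul]
    have e : ‖(2 * (q - p) : ℂ)‖ = 2 * (q - p) := by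
      rw [← Complex.ofReal_sub, norm_mul, Complex.norm_real, Real.norm_of_nonneg (by linarith)]
      simp
    rw [e]
    have : ‖mulL th (D U)‖ ≤ N :=
      (norm_mulL_le bddSmooth_th norm_th_le (D U)).trans (by rw [one_mul]; exact hU1)
    have h0 : 0 ≤ 2 * (q - p) := by linarith
    gcongr
  have t3 : ∀ a : ℝ, |a| = 1 →
      ‖mulL (fun x => coshRatio q a x - coshRatio p a x) (shift a (mulL σ U))‖ ≤
        Real.exp p * (Real.exp (q - p) - 1) * M * N := by
    intro a ha
    have hb := norm_coshRatio_diff_le hp hpq a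
    rw [ha, mul_one, mul_one] at hb
    refine (norm_mulL_le ((bddSmooth_coshRatio hq a).sub (bddSmooth_coshRatio hp a)) hb _).trans ?_
    rw [LinearIsometry.norm_map, mul_assoc _ M N]
    have h0 : 0 ≤ Real.exp (q - p) - 1 := by
      have := Real.add_one_le_exp (q - p)
      linarith
    have h1 : ‖mulL σ U‖ ≤ M * N := (norm_mulL_le hσ hM U).trans (by gcongr)
    gcongr
  rw [hdec]
  have hc2 : ‖(c : ℂ) ^ 2‖ = c ^ 2 := by
    rw [norm_pow, Complex.norm_real, Real.norm_eq_abs, sq_abs]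
  calc _ ≤ c ^ 2 * (((q ^ 2 - p ^ 2) + (q - p)) * N + 2 * (q - p) * N) +
        (Real.exp p * (Real.exp (q - p) - 1) * M * N +
          Real.exp p * (Real.exp (q - p) - 1) * M * N) := by
        refine (norm_sub_le _ _).trans (add_le_add ?_ ((norm_add_le _ _).trans (add_le_add
          (t3 1 (by simp)) (t3 (-1) (by simp)))))
        rw [norm_smul, hc2]
        gcongr
        exact (norm_sub_le _ _).trans (add_le_add t1 t2)
    _ = η q * N := by simp only [η]; ring
    _ ≤ ε * N := by gcongr

/-! ### Mean zero range -/

/-- Test against the cutoffs `b(x/(n+1))`: their derivatives are `O(1/n)` uniformly and `f` is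
integrable, while the other side tends to `∫ g` by dominated convergence. -/
theorem integral_eq_zero_of_weakDeriv {f g : L2} (h : WeakDeriv f g)
    (hf : Integrable f (volume : Measure ℝ)) (hg : Integrable g (volume : Measure ℝ)) :
    ∫ x, g x = 0 := by
  let b : ContDiffBump (0 : ℝ) := ⟨1, 2, by norm_num, by norm_num⟩
  have hb : ContDiff ℝ ((⊤ : ℕ∞) : WithTop ℕ∞) b := b.contDiff
  have hbc : HasCompactSupport b := b.hasCompactSupport
  have hdb : Continuous (deriv b) := hb.continuous_deriv (by simp)
  obtain ⟨M, hM⟩ := hdb.bounded_above_of_compact_support hbc.deriv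
  have hM0 : 0 ≤ M := (norm_nonneg _).trans (hM 0)
  let φ : ℕ → ℝ → ℝ := fun n x => b ((n + 1 : ℝ)⁻¹ * x)
  have hφd : ∀ n x, HasDerivAt (φ n) ((n + 1 : ℝ)⁻¹ * deriv b ((n + 1 : ℝ)⁻¹ * x)) x := by
    intro n x
    have h1 : HasDerivAt b (deriv b ((n + 1 : ℝ)⁻¹ * x)) ((n + 1 : ℝ)⁻¹ * x) :=
      (hb.differentiable (by simp) _).hasDerivAt
    have h2 := h1.comp x ((hasDerivAt_id x).const_mul ((n + 1 : ℝ)⁻¹))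
    convert! h2 using 1
    ring
  have key : ∀ n, ∫ x, φ n x • g x =
      -∫ x, ((n + 1 : ℝ)⁻¹ * deriv b ((n + 1 : ℝ)⁻¹ * x)) • f x := by
    intro n
    have hφs : ContDiff ℝ ((⊤ : ℕ∞) : WithTop ℕ∞) (φ n) := hb.comp (by fun_prop)
    have hφc : HasCompactSupport (φ n) :=
      hbc.comp_homeomorph (Homeomorph.mulLeft₀ ((n + 1 : ℝ)⁻¹) (by positivity))
    have hg₁ : HasCompactSupport (Complex.ofRealCLM ∘ φ n) := hφc.comp_left rfl
    have hg₂ : ContDiff ℝ ((⊤ : ℕ∞) : WithTop ℕ∞) (Complex.ofRealCLM ∘ φ n) := by fun_prop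
    have h1 := weakDeriv_iff_integral.1 h (hg₁.toSchwartzMap hg₂)
    have e2 : ∀ x, deriv (hg₁.toSchwartzMap hg₂) x =
        (((n + 1 : ℝ)⁻¹ * deriv b ((n + 1 : ℝ)⁻¹ * x) : ℝ) : ℂ) := fun x =>
      ((hφd n x).ofReal_comp).deriv
    simp only [e2] at h1
    exact h1
  have lim1 : Tendsto (fun n => ∫ x, φ n x • g x) atTop (nhds (∫ x, g x)) := by
    refine tendsto_integral_of_dominated_convergence (fun x => ‖g x‖) (fun n => ?_) hg.norm
      (fun n => Eventually.of_forall fun x => ?_) (Eventually.of_forall fun x => ?_)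
    · exact (continuous_iff_continuousAt.2 fun x => (hφd n x).continuousAt).aestronglyMeasurable.smul
        hg.aestronglyMeasurable
    · rw [norm_smul]
      refine mul_le_of_le_one_left (norm_nonneg _) ?_
      rw [Real.norm_of_nonneg (b.nonneg)]
      exact b.le_one
    · have h0 : Tendsto (fun n : ℕ => (n + 1 : ℝ)⁻¹ * x) atTop (nhds (0 * x)) := by
        refine Tendsto.mul_const x ?_
        simpa [one_div] using tendsto_one_div_add_atTop_nhds_zero_nat (𝕜 := ℝ)
      rw [zero_mul] at h0
      have h1 : Tendsto (fun n : ℕ => φ n x) atTop (nhds (b 0)) :=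
        (hb.continuous.tendsto 0).comp h0
      have h2 : b (0 : ℝ) = 1 := b.one_of_mem_closedBall (by simp [b])
      rw [h2] at h1
      simpa using h1.smul_const (g x)
  have lim2 : Tendsto (fun n : ℕ => -∫ x, ((n + 1 : ℝ)⁻¹ * deriv b ((n + 1 : ℝ)⁻¹ * x)) • f x)
      atTop (nhds 0) := by
    have h0 : Tendsto (fun n : ℕ => (n + 1 : ℝ)⁻¹ * (M * ∫ x, ‖f x‖)) atTop (nhds 0) := by
      rw [← zero_mul (M * ∫ x, ‖f x‖)]
      refine Tendsto.mul_const _ ?_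
      simpa [one_div] using tendsto_one_div_add_atTop_nhds_zero_nat (𝕜 := ℝ)
    refine squeeze_zero_norm (fun n => ?_) h0
    rw [norm_neg, ← mul_assoc, ← integral_const_mul]
    refine norm_integral_le_of_norm_le (hf.norm.const_mul _) (Eventually.of_forall fun x => ?_)
    rw [norm_smul, norm_mul, Real.norm_of_nonneg (by positivity : (0 : ℝ) ≤ (n + 1 : ℝ)⁻¹)]
    gcongr
    exact hM _
  refine tendsto_nhds_unique lim1 ?_
  simp only [key]
  exact lim2

end

section

/-! ### Orthogonality of the conjugated range to the weight. -/

theorem mulL_zero {m : ℝ → ℂ} (hm : BddSmooth m) : mulL m 0 = 0 := by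
  have := mulL_smul hm (0 : ℂ) 0
  simpa using this

theorem eq_zero_of_mulL_eq_zero {m : ℝ → ℂ} (hm : BddSmooth m) (h0 : ∀ x, m x ≠ 0) {f : L2}
    (h : mulL m f = 0) : f = 0 := by
  ext1
  filter_upwards [mulL_ae hm f, Lp.ext_iff.1 h, Lp.coeFn_zero ℂ 2 (volume : Measure ℝ)]
    with x a b d
  rw [d, Pi.zero_apply]
  rw [b, d, Pi.zero_apply] at a
  exact (mul_eq_zero.1 a.symm).resolve_left (h0 x)

theorem mulL_injective {m : ℝ → ℂ} (hm : BddSmooth m) (h0 : ∀ x, m x ≠ 0) {f g : L2}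
    (h : mulL m f = mulL m g) : f = g := by
  rw [← sub_eq_zero]
  refine eq_zero_of_mulL_eq_zero hm h0 ?_
  rw [mulL_sub hm, h, sub_self]

theorem integrable_mulL_coshNeg {q : ℝ} (hq : 0 < q) (U : L2) :
    Integrable (mulL (coshNeg q) U) (volume : Measure ℝ) :=
  (MemLp.integrable_mul (memLp_coshNeg hq) (Lp.memLp U)).congr
    (mulL_ae (bddSmooth_coshNeg hq.le) U).symm

/-- The derivative keeps the form `cosh^{-q}` times an `L²` function, which for `q > 0` makes it
integrable. -/
theorem D_mulL_coshNeg {q : ℝ} (hq : 0 ≤ q) {U : L2} (hU : U ∈ sobolev 1) :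
    D (mulL (coshNeg q) U) = mulL (coshNeg q) (D U - (q : ℂ) • mulL th U) := by
  have hm := bddSmooth_coshNeg hq
  rw [D_mulL hm (hasDerivAt_coshNeg q) hU, mulL_sub hm, mulL_smul hm, mulL_mulL hm bddSmooth_th]
  have h1 := hm.mul bddSmooth_th
  have h2 : BddSmooth fun x => -q * th x * coshNeg q x :=
    ((BddSmooth.const (-(q : ℂ))).mul bddSmooth_th).mul hm
  rw [sub_eq_add_neg]
  congr 1
  ext1
  filter_upwards [mulL_ae h1 U, mulL_ae h2 U,
    Lp.coeFn_neg ((q : ℂ) • mulL (fun x => coshNeg q x * th x) U),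
    Lp.coeFn_smul (q : ℂ) (mulL (fun x => coshNeg q x * th x) U)] with x a b d e
  rw [b, d, Pi.neg_apply, e, Pi.smul_apply, a, smul_eq_mul]
  ring

variable {c : ℝ} {σ : ℝ → ℂ}

/-- The integral of a second derivative vanishes, and translation invariance annihilates `∫ (2 -
A)(σ f)`. -/
theorem integral_conjOp_zero (hσ : BddSmooth σ) {q : ℝ} (hq : 0 < q) {U : L2}
    (hU : U ∈ sobolev 2) : ∫ x, conjOp c σ 0 (mulL (coshNeg q) U) x = 0 := by
  set f := mulL (coshNeg q) U with hf
  have hU1 : U ∈ sobolev 1 := sobolev_mono (by norm_num) hU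
  have hf2 : f ∈ sobolev 2 := mulL_mem_sobolev_two (bddSmooth_coshNeg hq.le) hU
  have hd : D f = mulL (coshNeg q) (D U - (q : ℂ) • mulL th U) := D_mulL_coshNeg hq.le hU1
  have hV : D U - (q : ℂ) • mulL th U ∈ sobolev 1 :=
    sub_mem (D_mem_sobolev_one hU) (Submodule.smul_mem _ _
      ((weakDeriv_D hU1).mulL bddSmooth_th).mem_sobolev_one)
  have i1 : Integrable (D f) := by rw [hd]; exact integrable_mulL_coshNeg hq _
  have i2 : Integrable (D (D f)) := by
    rw [hd, D_mulL_coshNeg hq.le hV]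
    exact integrable_mulL_coshNeg hq _
  have z2 : ∫ x, D (D f) x = 0 :=
    integral_eq_zero_of_weakDeriv (weakDeriv_D (D_mem_sobolev_one hf2)) i1 i2
  have i0 : Integrable (fun x => σ x * f x) := by
    obtain ⟨M, hM⟩ := hσ.bdd
    exact (integrable_mulL_coshNeg hq U).bdd_mul (c := M) hσ.continuous.aestronglyMeasurable
      (Eventually.of_forall hM)
  have ip : ∀ a : ℝ, Integrable (fun x => σ (x + a) * f (x + a)) := fun a => i0.comp_add_right a
  have iv : ∀ a : ℝ, ∫ x, σ (x + a) * f (x + a) = ∫ x, σ x * f x := fun a =>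
    integral_add_right_eq_self (fun x => σ x * f x) a
  have hr : ∀ a x, coshRatio 0 a x = 1 := fun a x => by simp [coshRatio]
  have hp : ∀ x, potential 0 x = 0 := fun x => by simp [potential]
  have hae : conjOp c σ 0 f =ᵐ[volume] fun x => (c : ℂ) ^ 2 * D (D f) x +
      (2 * (σ x * f x) - (σ (x + 1) * f (x + 1) + σ (x + -1) * f (x + -1))) := by
    filter_upwards [conjOp_ae (c := c) hσ le_rfl f] with x hx
    rw [hx, hr, hr, hp]
    simp
  rw [integral_congr_ae hae, integral_add (i2.const_mul _) (by
      exact (i0.const_mul 2).sub ((ip 1).add (ip (-1)))), integral_sub (i0.const_mul 2) (by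
      exact (ip 1).add (ip (-1))), integral_add (ip 1) (ip (-1)), iv, iv, integral_const_mul,
    integral_const_mul, z2]
  ring

open Classical in
/-- The weight `cosh^{-q}` as an element of `L²`, for `q > 0`. -/
def weightInv (q : ℝ) : L2 :=
  if h : MemLp (coshNeg q) 2 (volume : Measure ℝ) then h.toLp else 0

theorem weightInv_ae {q : ℝ} (hq : 0 < q) : weightInv q =ᵐ[volume] coshNeg q := by
  rw [weightInv, dif_pos (memLp_coshNeg hq)]
  exact MemLp.coeFn_toLp _

theorem inner_weightInv {q : ℝ} (hq : 0 < q) (G : L2) :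
    inner ℂ (weightInv q) G = ∫ x, mulL (coshNeg q) G x := by
  rw [L2.inner_def]
  refine integral_congr_ae ?_
  filter_upwards [weightInv_ae hq, mulL_ae (bddSmooth_coshNeg hq.le) G] with x a b
  rw [a, b, RCLike.inner_apply, coshNeg, Complex.conj_ofReal, mul_comm]

theorem inner_weightInv_conjOp (hσ : BddSmooth σ) {q : ℝ} (hq : 0 < q) {U : L2}
    (hU : U ∈ sobolev 2) : inner ℂ (weightInv q) (conjOp c σ q U) = 0 := by
  have h := mulL_coshNeg_conjOp (c := c) hσ le_rfl hq.le hU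
  rw [add_zero] at h
  rw [inner_weightInv hq, h]
  exact integral_conjOp_zero hσ hq hU

/-- The pairing is `∫ cosh^{-(p+q)} > 0`. Thus `cosh^{-p}` is transversal to the hyperplane
`(cosh^{-q})^⊥`, which lets one projection serve nearby weights. -/
theorem inner_weightInv_weightInv_ne_zero {p q : ℝ} (hp : 0 < p) (hq : 0 < q) :
    inner ℂ (weightInv p) (weightInv q) ≠ 0 := by
  have e : inner ℂ (weightInv p) (weightInv q) =
      ((∫ x : ℝ, Real.cosh x ^ (-(p + q)) : ℝ) : ℂ) := by
    rw [inner_weightInv hp, ← integral_complex_ofReal]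
    refine integral_congr_ae ?_
    filter_upwards [weightInv_ae hq, mulL_ae (bddSmooth_coshNeg hp.le) (weightInv q)] with x a b
    rw [b, a, coshNeg_add]
    rfl
  rw [e, Complex.ofReal_ne_zero]
  refine ne_of_gt ((integral_pos_iff_support_of_nonneg (fun x => Real.rpow_nonneg
    (Real.cosh_pos x).le _) (integrable_cosh_rpow_neg (by linarith))).2 ?_)
  have : Function.support (fun x => Real.cosh x ^ (-(p + q))) = Set.univ :=
    Set.eq_univ_of_forall fun x => (Real.rpow_pos_of_pos (Real.cosh_pos x) _).ne'
  rw [this]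
  simp

theorem weightInv_even {q : ℝ} (hq : 0 < q) : weightInv q ∈ evenL2 := by
  change ∀ᵐ x : ℝ, weightInv q (-x) = weightInv q x
  filter_upwards [weightInv_ae hq, ae_neg (weightInv_ae hq)] with x a b
  rw [a, b, coshNeg_even]

/-! ### Perturbation of the weight -/

/-- The conjugated operator has a bounded right inverse on even functions orthogonal to
`cosh^{-q}`. -/
def Solvable (c : ℝ) (σ : ℝ → ℂ) (q : ℝ) : Prop :=
  ∃ C : ℝ≥0, ∀ G ∈ evenL2, inner ℂ (weightInv q) G = 0 →
    ∃ U ∈ sobolev 2, U ∈ evenL2 ∧ conjOp c σ q U = G ∧ sobolevENorm 2 U ≤ C * ‖G‖ₑ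

/-- The conjugated operator is injective on even functions in `H²`. -/
def EvenInjective (c : ℝ) (σ : ℝ → ℂ) (q : ℝ) : Prop :=
  ∀ U ∈ sobolev 2, U ∈ evenL2 → conjOp c σ q U = 0 → U = 0

/-- Multiplication by `cosh^{-(q-p)}` is injective, preserves parity and `H²`, and maps the kernel
at `q` into the kernel at `p`. It is bounded because `q ≥ p`. -/
theorem EvenInjective.mono (hσ : BddSmooth σ) {p q : ℝ} (hp : 0 ≤ p) (hpq : p ≤ q)
    (h : EvenInjective c σ p) : EvenInjective c σ q := by
  intro U hU he h0
  have hm := bddSmooth_coshNeg (sub_nonneg.2 hpq)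
  have h1 := mulL_coshNeg_conjOp (c := c) hσ hp (sub_nonneg.2 hpq) hU
  rw [sub_add_cancel, h0, mulL_zero hm] at h1
  refine eq_zero_of_mulL_eq_zero hm (coshNeg_ne_zero _)
    (h _ (mulL_mem_sobolev_two hm hU) ?_ h1.symm)
  change ∀ᵐ x : ℝ, mulL (coshNeg (q - p)) U (-x) = mulL (coshNeg (q - p)) U x
  filter_upwards [mulL_ae hm U, ae_neg (mulL_ae hm U), show ∀ᵐ x : ℝ, U (-x) = U x from he]
    with x a b d
  rw [a, b, d, coshNeg_even]

/-! ### Even projection and the fixed-point argument. -/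

theorem refl_refl (f : L2) : refl (refl f) = f := by
  ext1
  filter_upwards [refl_ae (refl f), ae_neg (refl_ae f)] with x a b
  rw [a, b, neg_neg]

/-- The even part of a function. -/
def evenPart (f : L2) : L2 := (2⁻¹ : ℂ) • (f + refl f)

theorem evenPart_mem (f : L2) : evenPart f ∈ evenL2 := by
  rw [mem_evenL2_iff, evenPart, map_smul, map_add, refl_refl, add_comm]

theorem evenPart_of_mem {f : L2} (hf : f ∈ evenL2) : evenPart f = f := by
  rw [evenPart, (mem_evenL2_iff f).1 hf]
  module

theorem norm_evenPart_le (f : L2) : ‖evenPart f‖ ≤ ‖f‖ := by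
  rw [evenPart, norm_smul]
  have := norm_add_le f (refl f)
  rw [LinearIsometry.norm_map] at this
  norm_num
  linarith

/-- The projection onto the even functions orthogonal to `cosh^{-p}`. -/
def evenProj (p : ℝ) (f : L2) : L2 :=
  evenPart f - (inner ℂ (weightInv p) (evenPart f) / inner ℂ (weightInv p) (weightInv p) : ℂ) •
    weightInv p

theorem evenProj_sub (p : ℝ) (f g : L2) : evenProj p (f - g) = evenProj p f - evenProj p g := by
  have : evenPart (f - g) = evenPart f - evenPart g := by
    unfold evenPart
    rw [map_sub]
    module
  unfold evenProj
  rw [this, inner_sub_right, sub_div]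
  module

theorem evenProj_mem {p : ℝ} (hp : 0 < p) (f : L2) : evenProj p f ∈ evenL2 :=
  sub_mem (evenPart_mem f) (Submodule.smul_mem _ _ (weightInv_even hp))

theorem inner_evenProj {p : ℝ} (hp : 0 < p) (f : L2) :
    inner ℂ (weightInv p) (evenProj p f) = 0 := by
  rw [evenProj, inner_sub_right, inner_smul_right,
    div_mul_cancel₀ _ (inner_weightInv_weightInv_ne_zero hp hp), sub_self]

theorem evenProj_of_mem {p : ℝ} {f : L2} (hf : f ∈ evenL2) (h0 : inner ℂ (weightInv p) f = 0) :
    evenProj p f = f := by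
  rw [evenProj, evenPart_of_mem hf, h0, zero_div, zero_smul, sub_zero]

theorem norm_evenProj_le {p : ℝ} (hp : 0 < p) (f : L2) : ‖evenProj p f‖ ≤ 2 * ‖f‖ := by
  have hw : 0 < ‖weightInv p‖ := by
    rw [norm_pos_iff]
    intro h
    refine inner_weightInv_weightInv_ne_zero hp hp ?_
    rw [h, inner_zero_right]
  have h1 : ‖(inner ℂ (weightInv p) (evenPart f) / inner ℂ (weightInv p) (weightInv p) : ℂ) •
      weightInv p‖ ≤ ‖f‖ := by
    rw [norm_smul, norm_div, inner_self_eq_norm_sq_to_K]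
    have h2 : ‖inner ℂ (weightInv p) (evenPart f)‖ ≤ ‖weightInv p‖ * ‖f‖ :=
      (norm_inner_le_norm _ _).trans (by gcongr; exact norm_evenPart_le f)
    rw [norm_pow, RCLike.norm_ofReal, abs_norm, div_mul_eq_mul_div, div_le_iff₀ (by positivity)]
    nlinarith
  refine (norm_sub_le _ _).trans ?_
  linarith [norm_evenPart_le f]

/-- With `S` the inverse at `p`, `P` the projection `evenProj p` and `B` the difference of the
operators at `q` and `p`, the function `U = S y` solves the projected equation when `y = P z - P B S
y`. Transversality of the weights upgrades this to the full equation. -/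
theorem Solvable.exists_nhds (hσ : BddSmooth σ) (hσe : ∀ x, σ (-x) = σ x) {p : ℝ} (hp : 0 < p)
    (hs : Solvable c σ p) (hi : EvenInjective c σ p) :
    ∃ δ > 0, ∀ q, p ≤ q → q ≤ p + δ → Solvable c σ q := by
  obtain ⟨C, hC⟩ := hs
  have hC' : ∀ G ∈ evenL2, inner ℂ (weightInv p) G = 0 → ∃ U ∈ sobolev 2, U ∈ evenL2 ∧
      conjOp c σ p U = G ∧ (sobolevENorm 2 U).toReal ≤ C * ‖G‖ := by
    intro G hG h0
    obtain ⟨U, h1, h2, h3, h4⟩ := hC G hG h0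
    refine ⟨U, h1, h2, h3, ?_⟩
    have := ENNReal.toReal_mono (ENNReal.mul_ne_top ENNReal.coe_ne_top enorm_ne_top) h4
    simpa using this
  -- The projection costs a factor `2` twice, once inside `S` and once outside `B`, so `ε C ≤ 1/8`
  -- gives the contraction constant `1/2`.
  set ε : ℝ := 1 / (8 * (C + 1)) with hε
  have hC0 : (0 : ℝ) ≤ C := C.2
  have hεC : ε * C ≤ 1 / 8 := by
    rw [hε, div_mul_eq_mul_div, div_le_div_iff₀ (by positivity) (by norm_num)]
    linarith
  have hε0 : 0 < ε := by positivity
  obtain ⟨δ, hδ, hδε⟩ := exists_conjOp_sub_le (c := c) hσ hp.le hε0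
  refine ⟨δ, hδ, fun q hpq hqδ => ⟨4 * C, fun z hz hz0 => ?_⟩⟩
  have hq : 0 < q := hp.trans_le hpq
  -- The solutions are merely chosen; injectivity at `p` then forces `S` to respect differences,
  -- which gives the Lipschitz bound.
  choose S hS2 hSe hSeq hSn using fun y =>
    hC' (evenProj p y) (evenProj_mem hp y) (inner_evenProj hp y)
  have hSsub : ∀ y y', (sobolevENorm 2 (S y - S y')).toReal ≤ C * (2 * ‖y - y'‖) := by
    intro y y'
    have e : S y - S y' = S (y - y') := by
      rw [← sub_eq_zero]
      refine hi _ (sub_mem (sub_mem (hS2 _) (hS2 _)) (hS2 _))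
        (sub_mem (sub_mem (hSe _) (hSe _)) (hSe _)) ?_
      rw [conjOp_sub hσ hp.le (sub_mem (hS2 _) (hS2 _)) (hS2 _),
        conjOp_sub hσ hp.le (hS2 _) (hS2 _), hSeq, hSeq, hSeq, evenProj_sub, sub_self]
    rw [e]
    refine (hSn _).trans ?_
    gcongr
    exact norm_evenProj_le hp _
  let B : L2 → L2 := fun U => conjOp c σ q U - conjOp c σ p U
  have hBsub : ∀ U ∈ sobolev 2, ∀ V ∈ sobolev 2, B U - B V = B (U - V) := by
    intro U hU V hV
    simp only [B]
    rw [conjOp_sub hσ hq.le hU hV, conjOp_sub hσ hp.le hU hV]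
    abel
  let Φ : L2 → L2 := fun y => evenProj p z - evenProj p (B (S y))
  have hΦ : ContractingWith (1 / 2) Φ := by
    refine ⟨by norm_num, LipschitzWith.of_dist_le_mul fun y y' => ?_⟩
    rw [dist_eq_norm, dist_eq_norm]
    have e : Φ y - Φ y' = evenProj p (B (S y' - S y)) := by
      rw [← hBsub _ (hS2 _) _ (hS2 _), evenProj_sub]
      simp only [Φ]
      abel
    rw [e]
    have h1 := norm_evenProj_le hp (B (S y' - S y))
    have h2 := hδε q hpq hqδ (S y' - S y) (sub_mem (hS2 _) (hS2 _))
    have h3 := hSsub y' y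
    rw [norm_sub_rev] at h3
    have h4 : ε * (sobolevENorm 2 (S y' - S y)).toReal ≤ ε * (C * (2 * ‖y - y'‖)) := by gcongr
    have h5 : ε * C * (2 * ‖y - y'‖) ≤ 1 / 8 * (2 * ‖y - y'‖) := by gcongr
    push_cast
    linarith
  obtain ⟨y, hy, -⟩ := hΦ.exists_fixedPoint 0 (edist_ne_top _ _)
  have hfix : evenProj p z - evenProj p (B (S y)) = y := hy
  have hye : y ∈ evenL2 := by
    rw [← hfix]
    exact sub_mem (evenProj_mem hp _) (evenProj_mem hp _)
  have hy0 : inner ℂ (weightInv p) y = 0 := by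
    rw [← hfix, inner_sub_right, inner_evenProj hp, inner_evenProj hp, sub_zero]
  have hPy : evenProj p y = y := evenProj_of_mem hye hy0
  have hpS : conjOp c σ p (S y) = y := by rw [hSeq, hPy]
  have hqe : conjOp c σ q (S y) ∈ evenL2 := conjOp_even hσ hσe hq.le (hS2 y) (hSe y)
  have heq : conjOp c σ q (S y) = z := by
    have hee : conjOp c σ q (S y) - z ∈ evenL2 := sub_mem hqe hz
    have h1 : evenProj p (conjOp c σ q (S y) - z) = 0 := by
      have e : conjOp c σ q (S y) - z = B (S y) - (z - y) := by
        simp only [B]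
        rw [hpS]
        abel
      rw [e, evenProj_sub p (B (S y)), evenProj_sub p z, hPy, sub_eq_iff_eq_add.1 hfix]
      abel
    rw [evenProj, evenPart_of_mem hee, sub_eq_zero] at h1
    -- By `h1` the error is a multiple of `cosh^{-p}`. Both the range at `q` and `z` are orthogonal
    -- to `cosh^{-q}`, so the multiple is zero.
    have h2 : inner ℂ (weightInv q) (conjOp c σ q (S y) - z) = 0 := by
      rw [inner_sub_right, inner_weightInv_conjOp hσ hq (hS2 y), hz0, sub_zero]
    rw [h1, inner_smul_right] at h2
    have h3 := (mul_eq_zero.1 h2).resolve_right (inner_weightInv_weightInv_ne_zero hq hp)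
    rw [h3, zero_smul, sub_eq_zero] at h1
    exact h1
  refine ⟨S y, hS2 y, hSe y, heq, ?_⟩
  have hn := hSn y
  rw [hPy] at hn
  -- The fixed-point equation gives `‖y‖ ≤ 2‖z‖ + ‖y‖/4`, hence even the constant `8/3`.
  have hyn : ‖y‖ ≤ 4 * ‖z‖ := by
    have h1 := norm_evenProj_le hp z
    have h2 := norm_evenProj_le hp (B (S y))
    have h3 := hδε q hpq hqδ (S y) (hS2 y)
    have h4 : ε * (sobolevENorm 2 (S y)).toReal ≤ ε * (C * ‖y‖) := by gcongr
    have h5 : ε * C * ‖y‖ ≤ 1 / 8 * ‖y‖ := by gcongr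
    have h6 := norm_sub_le (evenProj p z) (evenProj p (B (S y)))
    rw [hfix] at h6
    have h7 : ‖B (S y)‖ ≤ ε * (sobolevENorm 2 (S y)).toReal := h3
    linarith [norm_nonneg y, norm_nonneg z]
  have hfin : sobolevENorm 2 (S y) ≠ ∞ := ((mem_sobolev_iff (by norm_num) _).1 (hS2 y)).ne
  rw [← ENNReal.toReal_le_toReal hfin (ENNReal.mul_ne_top ENNReal.coe_ne_top enorm_ne_top)]
  simp only [ENNReal.toReal_mul, ENNReal.coe_toReal, toReal_enorm, NNReal.coe_mul,
    NNReal.coe_ofNat]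
  calc (sobolevENorm 2 (S y)).toReal ≤ C * ‖y‖ := hn
    _ ≤ C * (4 * ‖z‖) := by gcongr
    _ = 4 * C * ‖z‖ := by ring

end

section

/-! ### Translation to the weighted spaces -/

theorem ae_eq_coshMul_iff {q : ℝ} (hq : 0 ≤ q) {f U : L2} :
    U =ᵐ[volume] coshMul q f ↔ f = mulL (coshNeg q) U := by
  have hm := bddSmooth_coshNeg hq
  constructor
  · intro h
    ext1
    filter_upwards [h, mulL_ae hm U] with x a b
    rw [b, a, coshMul, ← mul_assoc, coshNeg_mul_coshPow, one_mul]
  · rintro rfl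
    filter_upwards [mulL_ae hm U] with x b
    rw [coshMul, b, ← mul_assoc, mul_comm _ (coshNeg q x), coshNeg_mul_coshPow, one_mul]

/-- The infimum runs over a single function, since multiplication by `cosh^{-q}` is injective. -/
theorem weightedENorm_mulL_coshNeg {q : ℝ} (hq : 0 ≤ q) (r : ℝ) (U : L2) :
    weightedENorm r q (mulL (coshNeg q) U) = sobolevENorm r U := by
  refine le_antisymm (iInf₂_le U ((ae_eq_coshMul_iff hq).2 rfl)) (le_iInf₂ fun V hV => ?_)
  rw [mulL_injective (bddSmooth_coshNeg hq) (coshNeg_ne_zero q) ((ae_eq_coshMul_iff hq).1 hV)]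

theorem mulL_coshNeg_mem_evenL2_iff {q : ℝ} (hq : 0 ≤ q) {U : L2} :
    mulL (coshNeg q) U ∈ evenL2 ↔ U ∈ evenL2 := by
  have hm := bddSmooth_coshNeg hq
  change (∀ᵐ x : ℝ, mulL (coshNeg q) U (-x) = mulL (coshNeg q) U x) ↔ ∀ᵐ x : ℝ, U (-x) = U x
  refine Filter.eventually_congr ?_
  filter_upwards [mulL_ae hm U, ae_neg (mulL_ae hm U)] with x a b
  rw [a, b, coshNeg_even]
  exact mul_right_inj' (coshNeg_ne_zero q x)

theorem mem_E_iff {r q : ℝ} (hq : 0 ≤ q) {f : L2} :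
    f ∈ E r q ↔ f ∈ sobolev r ∧ ∃ U ∈ sobolev r, U ∈ evenL2 ∧ f = mulL (coshNeg q) U := by
  constructor
  · rintro ⟨⟨hf, U, hU, hUf⟩, he⟩
    have hfU := (ae_eq_coshMul_iff hq).1 hUf
    refine ⟨hf, U, hU, ?_, hfU⟩
    rw [hfU] at he
    exact (mulL_coshNeg_mem_evenL2_iff hq).1 he
  · rintro ⟨hf, U, hU, he, rfl⟩
    exact ⟨⟨hf, U, hU, (ae_eq_coshMul_iff hq).2 rfl⟩, (mulL_coshNeg_mem_evenL2_iff hq).2 he⟩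

theorem mulL_coshNeg_mem_meanZeroL2_iff {q : ℝ} (hq : 0 < q) {U : L2} :
    mulL (coshNeg q) U ∈ meanZeroL2 ↔ inner ℂ (weightInv q) U = 0 := by
  rw [inner_weightInv hq]
  exact and_iff_right (integrable_mulL_coshNeg hq U)

theorem mem_E₀_iff {r q : ℝ} (hq : 0 < q) {f : L2} :
    f ∈ E₀ r q ↔ f ∈ sobolev r ∧ ∃ U ∈ sobolev r, U ∈ evenL2 ∧ inner ℂ (weightInv q) U = 0 ∧
      f = mulL (coshNeg q) U := by
  rw [E₀, Submodule.mem_inf, mem_E_iff hq.le]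
  constructor
  · rintro ⟨⟨hf, U, hU, he, rfl⟩, h0⟩
    exact ⟨hf, U, hU, he, (mulL_coshNeg_mem_meanZeroL2_iff hq).1 h0, rfl⟩
  · rintro ⟨hf, U, hU, he, h0, rfl⟩
    exact ⟨⟨hf, U, hU, he, rfl⟩, (mulL_coshNeg_mem_meanZeroL2_iff hq).2 h0⟩

/-! ### Equivalence of invertibility with the conjugated problem. -/

variable {c : ℝ} {s : ℝ → ℂ} {ς : L2}

theorem bddSmooth_one_add_two_mul (hs : BddSmooth s) : BddSmooth fun x => 1 + 2 * s x :=
  (BddSmooth.const 1).add ((BddSmooth.const 2).mul hs)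

/-- At weight zero the ratios are `1` and the potential vanishes, so the conjugated operator is
`H_c` itself. -/
theorem linearization_ae (hs : BddSmooth s) (hςs : ς =ᵐ[volume] s) {f : L2} (hf : f ∈ sobolev 2) :
    conjOp c (fun x => 1 + 2 * s x) 0 f =ᵐ[volume] linearization c ς f := by
  filter_upwards [conjOp_ae (c := c) (bddSmooth_one_add_two_mul hs) le_rfl f, hςs,
    ae_add_const 1 hςs, ae_add_const (-1) hςs] with x h1 h2 h3 h4
  rw [h1, linearization, secondDeriv_eq hf]
  simp only [twoSubA, sub_eq_add_neg x 1]
  rw [h2, h3, h4]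
  have hr : ∀ a, coshRatio 0 a x = 1 := fun a => by simp [coshRatio]
  have hp : potential 0 x = 0 := by simp [potential]
  rw [hr, hr, hp]
  simp

theorem conjOp_zero_mulL_coshNeg {σ : ℝ → ℂ} (hσ : BddSmooth σ) {q : ℝ} (hq : 0 ≤ q) {U : L2}
    (hU : U ∈ sobolev 2) :
    conjOp c σ 0 (mulL (coshNeg q) U) = mulL (coshNeg q) (conjOp c σ q U) := by
  have := mulL_coshNeg_conjOp (c := c) hσ le_rfl hq hU
  rw [add_zero] at this
  exact this.symm

theorem IsInvertible.solvable (hs : BddSmooth s) (hςs : ς =ᵐ[volume] s) {q : ℝ} (hq : 0 < q)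
    (h : IsInvertible c ς 2 0 q) : Solvable c (fun x => 1 + 2 * s x) q := by
  obtain ⟨T, hT, -, C, hC⟩ := h
  refine ⟨C, fun G hG h0 => ?_⟩
  have hgE : mulL (coshNeg q) G ∈ E₀ 0 q :=
    (mem_E₀_iff hq).2 ⟨mem_sobolev_zero _, G, mem_sobolev_zero _, hG, h0, rfl⟩
  have hCg := hC ⟨_, hgE⟩
  have hTg := hT (T.symm ⟨_, hgE⟩)
  rw [LinearEquiv.apply_symm_apply] at hTg
  obtain ⟨hf, U, hU, hUe, hfU⟩ := (mem_E_iff hq.le).1 (T.symm ⟨_, hgE⟩).2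
  have hlin := linearization_ae (c := c) hs hςs hf
  rw [hfU, weightedENorm_mulL_coshNeg hq.le, weightedENorm_mulL_coshNeg hq.le,
    sobolevENorm_zero_index] at hCg
  refine ⟨U, hU, hUe, ?_, hCg⟩
  refine mulL_injective (bddSmooth_coshNeg hq.le) (coshNeg_ne_zero q) ?_
  rw [← conjOp_zero_mulL_coshNeg (bddSmooth_one_add_two_mul hs) hq.le hU, ← hfU]
  ext1
  exact hlin.trans hTg.symm

theorem IsInvertible.evenInjective (hs : BddSmooth s) (hςs : ς =ᵐ[volume] s) {q : ℝ} (hq : 0 < q)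
    (h : IsInvertible c ς 2 0 q) : EvenInjective c (fun x => 1 + 2 * s x) q := by
  obtain ⟨T, hT, -, -⟩ := h
  intro U hU he h0
  have hm := bddSmooth_coshNeg hq.le
  have hf2 := mulL_mem_sobolev_two hm hU
  have hfE : mulL (coshNeg q) U ∈ E 2 q := (mem_E_iff hq.le).2 ⟨hf2, U, hU, he, rfl⟩
  have hTf := hT ⟨_, hfE⟩
  have hlin := linearization_ae (c := c) hs hςs hf2
  rw [conjOp_zero_mulL_coshNeg (bddSmooth_one_add_two_mul hs) hq.le hU, h0, mulL_zero hm] at hlin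
  have hz : T ⟨_, hfE⟩ = 0 := by
    refine Subtype.ext ?_
    ext1
    exact hTf.trans hlin.symm
  have := congrArg Subtype.val ((LinearEquiv.map_eq_zero_iff T).1 hz)
  exact eq_zero_of_mulL_eq_zero hm (coshNeg_ne_zero q) this

/-- Solvability and injectivity at the level `H² → L²` suffice for every `r`: the `H²` solution is
smoothed by elliptic regularity, with the corresponding estimate. -/
theorem isInvertible_of_solvable (hc : c ≠ 0) (hs : BddSmooth s) (hse : ∀ x, s (-x) = s x)
    (hςs : ς =ᵐ[volume] s) {q : ℝ} (hq : 0 < q)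
    (hsol : Solvable c (fun x => 1 + 2 * s x) q)
    (hinj : EvenInjective c (fun x => 1 + 2 * s x) q) {r : ℝ} (hr : 0 ≤ r) :
    IsInvertible c ς (r + 2) r q := by
  set σ : ℝ → ℂ := fun x => 1 + 2 * s x with hσdef
  have hσ : BddSmooth σ := bddSmooth_one_add_two_mul hs
  have hσe : ∀ x, σ (-x) = σ x := fun x => by simp only [hσdef, hse]
  have hm := bddSmooth_coshNeg hq.le
  have h2r : sobolev (r + 2) ≤ sobolev 2 := sobolev_mono (by linarith)
  obtain ⟨C₀, hC₀⟩ := sobolevBdd_conjOp (c := c) hσ le_rfl hr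
  obtain ⟨C₁, hC₁⟩ := sobolevBdd_conjOp (c := c) hσ hq.le hr
  obtain ⟨C₂, hC₂⟩ := conjOp_regularity hc hσ hq.le hr
  obtain ⟨C₃, hC₃⟩ := conjOp_regularity hc hσ (le_refl 0) hr
  obtain ⟨C₄, hC₄⟩ := hsol
  have hmap : ∀ f ∈ E (r + 2) q, conjOp c σ 0 f ∈ E₀ r q := by
    intro f hf
    obtain ⟨hfs, U, hU, he, rfl⟩ := (mem_E_iff hq.le).1 hf
    exact (mem_E₀_iff hq).2 ⟨(hC₀ _ hfs).1, conjOp c σ q U, (hC₁ _ hU).1,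
      conjOp_even hσ hσe hq.le (h2r hU) he, inner_weightInv_conjOp hσ hq (h2r hU),
      conjOp_zero_mulL_coshNeg hσ hq.le (h2r hU)⟩
  have hE2 : ∀ f : E (r + 2) q, (f : L2) ∈ sobolev 2 := fun f =>
    h2r ((mem_E_iff hq.le).1 f.2).1
  let T₀ : E (r + 2) q →ₗ[ℂ] E₀ r q :=
    { toFun := fun f => ⟨conjOp c σ 0 f, hmap f f.2⟩
      map_add' := fun f g => Subtype.ext (conjOp_add hσ le_rfl (hE2 f) (hE2 g))
      map_smul' := fun a f => Subtype.ext (conjOp_smul hσ le_rfl a (hE2 f)) }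
  have hT₀ : ∀ f, (T₀ f : L2) = conjOp c σ 0 f := fun f => rfl
  have hker : Function.Injective T₀ := by
    rw [injective_iff_map_eq_zero]
    intro f hf
    have h0 : conjOp c σ 0 f = 0 := congrArg Subtype.val hf
    obtain ⟨-, U, hU, he, hfU⟩ := (mem_E_iff hq.le).1 f.2
    rw [hfU, conjOp_zero_mulL_coshNeg hσ hq.le (h2r hU)] at h0
    have hU0 := hinj U (h2r hU) he (eq_zero_of_mulL_eq_zero hm (coshNeg_ne_zero q) h0)
    refine Subtype.ext ?_
    rw [hfU, hU0, mulL_zero hm]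
    rfl
  have hpre : ∀ g : E₀ r q, ∃ f : E (r + 2) q, T₀ f = g ∧
      weightedENorm (r + 2) q f ≤ (C₂ * (C₄ + 1) : ℝ≥0) * weightedENorm r q g := by
    intro g
    obtain ⟨hgs, G, hG, hGe, hG0, hgG⟩ := (mem_E₀_iff hq).1 g.2
    obtain ⟨U, hU, hUe, hUG, hUn⟩ := hC₄ G hGe hG0
    obtain ⟨hUr, hUrn⟩ := hC₂ U hU (hUG.symm ▸ hG)
    have hfg : conjOp c σ 0 (mulL (coshNeg q) U) = g := by
      rw [conjOp_zero_mulL_coshNeg hσ hq.le hU, hUG, hgG]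
    -- The weighted space also requires `f` itself in `H^{r+2}`. For real `r` this comes from
    -- elliptic regularity at weight zero, since multiplication by `cosh^{-q}` is controlled only at
    -- integer orders.
    have hfr := (hC₃ _ (mulL_mem_sobolev_two hm hU) (hfg.symm ▸ hgs)).1
    refine ⟨⟨mulL (coshNeg q) U, (mem_E_iff hq.le).2 ⟨hfr, U, hUr, hUe, rfl⟩⟩,
      Subtype.ext hfg, ?_⟩
    rw [hgG, weightedENorm_mulL_coshNeg hq.le, weightedENorm_mulL_coshNeg hq.le]
    refine hUrn.trans ?_
    rw [hUG]
    push_cast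
    rw [mul_assoc, add_mul, one_mul]
    gcongr
    refine hUn.trans ?_
    gcongr
    exact enorm_le_sobolevENorm hr G
  let T : E (r + 2) q ≃ₗ[ℂ] E₀ r q := LinearEquiv.ofBijective T₀
    ⟨hker, fun g => (hpre g).imp fun f hf => hf.1⟩
  have hT : ∀ f, T f = T₀ f := fun f => rfl
  refine ⟨T, fun f => ?_, ⟨C₁, fun f => ?_⟩, ⟨C₂ * (C₄ + 1), fun g => ?_⟩⟩
  · rw [hT, hT₀]
    exact linearization_ae hs hςs (hE2 f)
  · obtain ⟨-, U, hU, he, hfU⟩ := (mem_E_iff hq.le).1 f.2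
    rw [hT, hT₀, hfU, conjOp_zero_mulL_coshNeg hσ hq.le (h2r hU),
      weightedENorm_mulL_coshNeg hq.le, weightedENorm_mulL_coshNeg hq.le]
    exact (hC₁ U hU).2
  · obtain ⟨f, hf, hfn⟩ := hpre g
    have : T.symm g = f := by
      rw [LinearEquiv.symm_apply_eq, hT, hf]
    rw [this]
    exact hfn

end

end MonatomicFPUT

end

/-! ### Choice of the interval of weights. -/

theorem proposition5p1 (c : ℝ) (hc : 1 < |c|)
    (qς : ℝ) (hqς : 0 < qς)
    (ς : MonatomicFPUT.L2)
    (hς_mem : ς ∈ MonatomicFPUT.E 2 qς)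
    (hς_real : ∀ᵐ x : ℝ, (ς x).im = 0)
    (hς_wave : MonatomicFPUT.IsTravelingWave c ς)
    (qH : ℝ) (hqH : 0 < qH) (hqH' : qH < min 1 qς)
    (hH : MonatomicFPUT.IsInvertible c ς 2 0 qH) :
    ∃ q₁ q₂ : ℝ, qH ≤ q₁ ∧ q₁ < q₂ ∧ q₂ < min 1 qς ∧
      ∀ q ∈ Set.Icc q₁ q₂, ∀ r : ℝ, 0 ≤ r →
        MonatomicFPUT.IsInvertible c ς (r + 2) r q := by
  have hc0 : c ≠ 0 := by
    rintro rfl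
    simp at hc
    linarith
  obtain ⟨s, hs, hςs, hse⟩ :=
    MonatomicFPUT.exists_bddSmooth_rep hc0 hς_mem.1.1 hς_mem.2 hς_wave
  have hσ := MonatomicFPUT.bddSmooth_one_add_two_mul hs
  have hsol := hH.solvable hs hςs hqH
  have hinj := hH.evenInjective hs hςs hqH
  obtain ⟨δ, hδ, hnear⟩ := hsol.exists_nhds hσ (fun x => by simp only [hse]) hqH hinj
  -- The left endpoint is `qH`, because injectivity passes only to larger weights. The right
  -- endpoint stays below both `min 1 qς` and `qH + δ`, with `δ` independent of `r`.
  obtain ⟨q₂, h1, h2⟩ := exists_between (lt_min hqH' (lt_add_of_pos_right qH hδ))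
  refine ⟨qH, q₂, le_rfl, h1, h2.trans_le (min_le_left _ _), fun q hq r hr => ?_⟩
  exact MonatomicFPUT.isInvertible_of_solvable hc0 hs hse hςs (hqH.trans_le hq.1)
    (hnear q hq.1 (hq.2.trans (h2.trans_le (min_le_right _ _)).le))
    (hinj.mono hσ hqH.le hq.1) hr
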